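/- **Setting.** Let $f:\mathbb R^n\to\mathbb R$, $A\in\mathbb R^{m\times n}$, $b\in\mathbb R^m$, $\lambda>0$, let $h(u)=\|u_+\|_0$ be the number of positive entries of $u\in\mathbb R^m$, and consider $$\min_{x,u}\; f(x)+\lambda h(u)\quad\text{s.t.}\quad Ax+b=u .$$ Assume that $f$ is $C^2$ and coercive, that $f+\frac{\sigma_f}{2}\|\cdot\|^2$ is convex, that $\nabla f$ and $\nabla^2 f$ are Lipschitz with moduli $\ell_f$ and $L_f$, and that $A$ has full row rank; let $\gamma>0$ with $\gamma^2=\lambda_{\min}(AA^\top)$. For $\rho,\mu>0$ put $$\mathcal L_\rho(x,u,y)=f(x)+\langle y,Ax+b-u\rangle+\tfrac\rho2\|Ax+b-u\|^2+\lambda h(u),\qquad \mathcal V_{\rho,\mu}(x,u,y,v)=\mathcal L_\rho(x,u,y)+\tfrac\mu2\|x-v\|^2 .$$ For $\psi:\mathbb R^m\to\mathbb R$ let $\operatorname{Prox}_{\psi}(w)=\arg\min_z\{\psi(z)+\frac12\|z-w\|^2\}$ and let $\Phi_\psi(w)$ be the minimum value. **Inner method (GSNewton)** for $\min_{x,u}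 G(x,u)=g(x,u)+\lambda h(u)$, where $g(x,u)=f(x)+\langle y,Ax+b-u\rangle+\frac\rho2\|Ax+b-u\|^2+\frac\mu2\|x-v\|^2$, with $\mu>\sigma_f$, $0<\alpha<1/\ell_g$ and $0<t<2/\ell_g$, where $\ell_g>0$ is a Lipschitz modulus of $\nabla g$ (uniform in $y,v$). Write $\Gamma(x,u)=\{i: [u-\alpha\nabla_u g(x,u)]_i\in[0,\sqrt{2\alpha\lambda})\}$. From $\zeta^j=(x^j,u^j)$, with $\Gamma_j=\Gamma(\zeta^j)$, form $\zeta^{j+1/2}$ by $u^{j+1/2}_{\Gamma_j}=0$, $u^{j+1/2}_i=[u^j-\alpha\nabla_u g(\zeta^j)]_i$ for $i\notin\Gamma_j$, and $x^{j+1/2}=x^j-t\nabla_x g(x^j,u^{j+1/2})$. Let $\tilde\zeta^{j+1}$ be the Newton point for $g$ at $\zeta^{j+1/2}$ on the subspace $u_{\Gamma_j}=0$ (the gradient and the Hessian of $g$ being truncated to the variables $x$ and $u_i$, $i\notin\Gamma_j$). Set $\zeta^{j+1}=\tilde\zeta^{j+1}$ if $G(\zeta^{j+1/2})-G(\tilde\zeta^{j+1})\ge\frac{\mu-\sigma_f}{4}\|\tilde\zeta^{j+1}-\zeta^{j+1/2}\|^2$,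 and $\zeta^{j+1}=\zeta^{j+1/2}$ otherwise. **iNALM.** Let $c_1,c_2>0$, $\epsilon_k>0$, $\epsilon_k\to0$, and let $(x^0,u^0,y^0)$ be arbitrary. At iteration $k$ let $g_k$ and $G_k$ be $g$ and $G$ with $y=y^k$, $v=x^k$. Run GSNewton from $(x^k,u^k)$ on $G_k$ and let $(x^{k+1},u^{k+1})$ be an inner iterate $(x,u)$ (for instance the first one) that satisfies, with $\Gamma=\Gamma(x,u)$ formed with $g=g_k$, $$\|\nabla_x g_k(x,u)\|\le c_1\|x-x^k\|,\qquad \big\|[u_\Gamma;\alpha(\nabla_u g_k(x,u))_{\Gamma^c}]\big\|\le c_2\|x-x^k\|^2,$$ $$\tfrac{\alpha^2}{2}\|\nabla_u g_k(x,u)\|^2+\alpha\lambda h(u)-\Phi_{\alpha\lambda h}(u-\alpha\nabla_u g_k(x,u))\le\epsilon_k .$$ If the $x$-parts of the inner iterates converge to $x^k$, one may instead take for $(x^{k+1},u^{k+1})$ a pair $(x,u)$ with $x=x^k$ that satisfies $\nabla_x g_k(x,u)=0$, $u\in\operatorname{Prox}_{\alpha\lambda h}(u-\alpha\nabla_u g_k(x,u))$,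 the three inequalities above, and $G_k(x,u)\le G_k(x^k,u^k)$. Then put $y^{k+1}=y^k+\rho(Ax^{k+1}+b-u^{k+1})$. The parameters satisfy $\mu>0$ and $$c_3=\frac{\mu+\ell_f+c_1}{\gamma},\quad c_4=\frac{\mu+c_1}{\gamma},\quad \rho>\max\Big\{\frac{8(c_3^2+c_4^2)}{\mu},\frac{4\ell_f}{\gamma^2}\Big\},\quad \beta=\frac{4c_4^2}{\rho}.$$ **Theorem.** Let $(x^k,u^k,y^k)_{k\ge0}$ be generated by iNALM and let $(x^*,u^*,y^*)$ be an accumulation point at which the second-order sufficient condition holds: $d^\top\nabla^2 f(x^*)d>0$ for every $d\ne0$ with $(Ad)_i=0$ whenever $u_i^*=0<y_i^*$ and $(Ad)_i\le0$ whenever $u_i^*=y_i^*=0$. Put $\mathcal V_k=\mathcal V_{\rho,\beta}(x^k,u^k,y^k,x^{k-1})$ for $k\ge1$ and $\mathcal V_*=\mathcal V_{\rho,\beta}(x^*,u^*,y^*,x^*)$. Then there are $q\in(0,1)$, $c_\nu>0$ and $k_\nu\ge1$ with $$\mathcal V_k-\mathcal V_*\le c_\nu q^k\qquad\text{for all }k\ge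 k_\nu, \tag{1}$$ and for every $q\in(0,1)$ for which (1) holds with some $c_\nu>0$ and $k_\nu\ge1$ there are an index $k^*$ and constants $c_x,c_y,c_u>0$ such that, for all $k\ge k^*$, $$\|x^k-x^*\|\le c_x(\sqrt q)^k,\qquad \|y^k-y^*\|\le c_y(\sqrt q)^k,\qquad \|u^k-u^*\|\le c_u(\sqrt q)^k .$$ In particular the iterates converge R-linearly to $(x^*,u^*,y^*)$. -/

import Mathlib

noncomputable section

/-- `ℝⁿ` with the Euclidean norm. -/
abbrev Euc (n : ℕ) : Type := EuclideanSpace ℝ (Fin n)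

/-- The 0/1 loss `h(u) = ‖u₊‖₀`, the number of positive entries of `u`. -/
def zeroOneLoss {m : ℕ} (u : Euc m) : ℝ :=
  ((Finset.univ.filter (fun i => 0 < u i)).card : ℝ)

/-- The set-valued proximal operator of `ψ`. -/
def proxSet {m : ℕ} (ψ : Euc m → ℝ) (v : Euc m) : Set (Euc m) :=
  {z | ∀ w : Euc m, ψ z + (1 / 2) * ‖z - v‖ ^ 2 ≤ ψ w + (1 / 2) * ‖w - v‖ ^ 2}

/-- The Moreau envelope of `ψ` (used for `ψ` bounded below only). -/
def moreauEnv {m : ℕ} (ψ : Euc m → ℝ) (v : Euc m) : ℝ :=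
  ⨅ z : Euc m, (ψ z + (1 / 2) * ‖z - v‖ ^ 2)

/-- The Hessian of `f` at `x`, as a linear operator. -/
def hessian {n : ℕ} (f : Euc n → ℝ) (x : Euc n) : Euc n →L[ℝ] Euc n :=
  fderiv ℝ (gradient f) x

/-- The vector that agrees with `w` on the index set `S` and is zero elsewhere. -/
def restrictTo {m : ℕ} (S : Finset (Fin m)) (w : Euc m) : Euc m :=
  WithLp.toLp 2 (fun i => if i ∈ S then w i else 0)

/-- The data of `min f(x) + lam * h(u)` subject to `A x + b = u`. -/
structure ZeroOneCOP (n m : ℕ) where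
  f : Euc n → ℝ
  A : Matrix (Fin m) (Fin n) ℝ
  b : Euc m
  lam : ℝ

/-- The parameters of the algorithm: penalty `rho`, proximal weight `mu`, weak convexity modulus
`sigma`, step lengths `alpha` and `t`, and the tolerances of the stopping test. -/
structure NALMParams where
  rho : ℝ
  mu : ℝ
  sigma : ℝ
  alpha : ℝ
  t : ℝ
  c₁ : ℝ
  c₂ : ℝ
  eps : ℕ → ℝ

namespace ZeroOneCOP

variable {n m : ℕ} (P : ZeroOneCOP n m) (S : NALMParams)

/-- `x ↦ A x`. -/
def mulA (x : Euc n) : Euc m := Matrix.toEuclideanLin P.A x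

/-- `y ↦ Aᵀ y`. -/
def mulAT (y : Euc m) : Euc n := Matrix.toEuclideanLin P.A.transpose y

/-- The constraint residual `A x + b - u`. -/
def resid (x : Euc n) (u : Euc m) : Euc m := P.mulA x + P.b - u

/-- The augmented Lagrangian `L_ρ(x, u, y)`. -/
def augLag (ρ : ℝ) (x : Euc n) (u y : Euc m) : ℝ :=
  P.f x + inner ℝ y (P.resid x u) + ρ / 2 * ‖P.resid x u‖ ^ 2 + P.lam * zeroOneLoss u

/-- The Lyapunov function `V_{ρ,μ}(x, u, y, v)`. -/
def lyap (ρ μ : ℝ) (x : Euc n) (u y : Euc m) (v : Euc n) : ℝ :=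
  P.augLag ρ x u y + μ / 2 * ‖x - v‖ ^ 2

/-- The smooth part `g` of the subproblem with multiplier `y` and prox center `v`. -/
def subSmooth (y : Euc m) (v : Euc n) (x : Euc n) (u : Euc m) : ℝ :=
  P.f x + inner ℝ y (P.resid x u) + S.rho / 2 * ‖P.resid x u‖ ^ 2 + S.mu / 2 * ‖x - v‖ ^ 2

/-- The objective `G = g + lam * h` of the subproblem. -/
def subObj (y : Euc m) (v : Euc n) (x : Euc n) (u : Euc m) : ℝ :=
  P.subSmooth S y v x u + P.lam * zeroOneLoss u

/-- `∇ₓ g (x, u)`. -/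
def gradX (y : Euc m) (v : Euc n) (x : Euc n) (u : Euc m) : Euc n :=
  gradient (fun x' => P.subSmooth S y v x' u) x

/-- `∇ᵤ g (x, u)`. -/
def gradU (y : Euc m) (v : Euc n) (x : Euc n) (u : Euc m) : Euc m :=
  gradient (fun u' => P.subSmooth S y v x u') u

/-- `ℓ` is a Lipschitz modulus of `∇g = (∇ₓ g, ∇ᵤ g)`, uniformly over all subproblems, for the
Euclidean norm of `ℝⁿ × ℝᵐ`. -/
def IsGradLipschitzModulus (ℓ : ℝ) : Prop :=
  ∀ (y : Euc m) (v : Euc n) (x x' : Euc n) (u u' : Euc m),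
    Real.sqrt (‖P.gradX S y v x u - P.gradX S y v x' u'‖ ^ 2
      + ‖P.gradU S y v x u - P.gradU S y v x' u'‖ ^ 2)
      ≤ ℓ * Real.sqrt (‖x - x'‖ ^ 2 + ‖u - u'‖ ^ 2)

/-- `(x, u)`, with multiplier `-∇ᵤ g(x, u)`, is P-stationary for the subproblem. -/
def SubPStationary (y : Euc m) (v : Euc n) (x : Euc n) (u : Euc m) : Prop :=
  P.gradX S y v x u = 0 ∧
    u ∈ proxSet (fun w => S.alpha * P.lam * zeroOneLoss w) (u - S.alpha • P.gradU S y v x u)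

/-- The active set `Γ = {i : [u - α ∇ᵤ g(x, u)]_i ∈ [0, √(2αλ))}`. -/
def activeSet (y : Euc m) (v : Euc n) (x : Euc n) (u : Euc m) : Finset (Fin m) :=
  Finset.univ.filter (fun i => 0 ≤ (u - S.alpha • P.gradU S y v x u) i ∧
    (u - S.alpha • P.gradU S y v x u) i < Real.sqrt (2 * S.alpha * P.lam))

/-- The `u`-part of the gradient half-step. -/
def halfU (y : Euc m) (v : Euc n) (x : Euc n) (u : Euc m) : Euc m :=
  restrictTo (P.activeSet S y v x u)ᶜ (u - S.alpha • P.gradU S y v x u)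

/-- The `x`-part of the gradient half-step. -/
def halfX (y : Euc m) (v : Euc n) (x : Euc n) (u : Euc m) : Euc n :=
  x - S.t • P.gradX S y v x (P.halfU S y v x u)

/-- `(xt, ut)` solves the Newton equation at `(xh, uh)` on the subspace `u_Γ = 0`: the system matrix
is the Hessian of `g` truncated to the variables `x` and `u_i`, `i ∉ Γ`. -/
def IsNewtonPoint (y : Euc m) (v : Euc n) (Γ : Finset (Fin m)) (xh : Euc n) (uh : Euc m)
    (xt : Euc n) (ut : Euc m) : Prop :=
  hessian P.f xh (xt - xh) + S.rho • P.mulAT (P.mulA (xt - xh)) + S.mu • (xt - xh)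
      - S.rho • P.mulAT (restrictTo Γᶜ (ut - uh)) = -P.gradX S y v xh uh ∧
  (∀ i, i ∉ Γ →
    -(S.rho * P.mulA (xt - xh) i) + S.rho * (ut - uh) i = -(P.gradU S y v xh uh i)) ∧
  (∀ i, i ∈ Γ → ut i = 0)

/-- One iteration of the gradient-subspace-Newton method from `(x, u)` to `(x', u')`: the Newton
point is taken if it decreases `G` enough, and the half-step point otherwise. -/
def GSNewtonStep (y : Euc m) (v : Euc n) (x : Euc n) (u : Euc m) (x' : Euc n) (u' : Euc m) : Prop :=
  ∃ (xt : Euc n) (ut : Euc m),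
    P.IsNewtonPoint S y v (P.activeSet S y v x u) (P.halfX S y v x u) (P.halfU S y v x u) xt ut ∧
    (((S.mu - S.sigma) / 4 * (‖xt - P.halfX S y v x u‖ ^ 2 + ‖ut - P.halfU S y v x u‖ ^ 2)
          ≤ P.subObj S y v (P.halfX S y v x u) (P.halfU S y v x u) - P.subObj S y v xt ut ∧
        x' = xt ∧ u' = ut) ∨
      (¬ ((S.mu - S.sigma) / 4 * (‖xt - P.halfX S y v x u‖ ^ 2 + ‖ut - P.halfU S y v x u‖ ^ 2)
          ≤ P.subObj S y v (P.halfX S y v x u) (P.halfU S y v x u) - P.subObj S y v xt ut) ∧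
        x' = P.halfX S y v x u ∧ u' = P.halfU S y v x u))

/-- `(X, U)` is the sequence generated by the gradient-subspace-Newton method from `(x, u)`. -/
def IsGSNewtonRun (y : Euc m) (v : Euc n) (x : Euc n) (u : Euc m)
    (X : ℕ → Euc n) (U : ℕ → Euc m) : Prop :=
  X 0 = x ∧ U 0 = u ∧ ∀ j, P.GSNewtonStep S y v (X j) (U j) (X (j + 1)) (U (j + 1))

/-- The residual of `∇ₓ g = 0`. -/
def res₁ (y : Euc m) (v : Euc n) (x : Euc n) (u : Euc m) : ℝ := ‖P.gradX S y v x u‖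

/-- The norm of `[u_Γ ; α (∇ᵤ g)_{Γᶜ}]`. -/
def res₂ (y : Euc m) (v : Euc n) (x : Euc n) (u : Euc m) : ℝ :=
  ‖restrictTo (P.activeSet S y v x u) u
    + restrictTo (P.activeSet S y v x u)ᶜ (S.alpha • P.gradU S y v x u)‖

/-- The residual of the Moreau envelope identity. -/
def res₃ (y : Euc m) (v : Euc n) (x : Euc n) (u : Euc m) : ℝ :=
  S.alpha ^ 2 / 2 * ‖P.gradU S y v x u‖ ^ 2 + S.alpha * P.lam * zeroOneLoss u
    - moreauEnv (fun w => S.alpha * P.lam * zeroOneLoss w) (u - S.alpha • P.gradU S y v x u)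

/-- The stopping test of outer iteration `k`, whose current `x`-iterate is `v`. -/
def StopTest (k : ℕ) (y : Euc m) (v : Euc n) (x : Euc n) (u : Euc m) : Prop :=
  P.res₁ S y v x u ≤ S.c₁ * ‖x - v‖ ∧
  P.res₂ S y v x u ≤ S.c₂ * ‖x - v‖ ^ 2 ∧
  P.res₃ S y v x u ≤ S.eps k

/-- Primal step of outer iteration `k`, from `(x, u)` with multiplier `y` to `(x', u')`. Regularly,
`(x', u')` is an inner iterate of the method started at `(x, u)` that passes the stopping test (the
first such iterate is a special case). If the `x`-part of the inner sequence converges to `x` itself,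
`(x', u')` may also be a P-stationary point of the subproblem with `x' = x` that passes the stopping
test and does not increase the objective of the subproblem. -/
def PrimalStep (k : ℕ) (x : Euc n) (u y : Euc m) (x' : Euc n) (u' : Euc m) : Prop :=
  ∃ (X : ℕ → Euc n) (U : ℕ → Euc m), P.IsGSNewtonRun S y x x u X U ∧
    ((∃ j, P.StopTest S k y x (X j) (U j) ∧ x' = X j ∧ u' = U j) ∨
      (Filter.Tendsto X Filter.atTop (nhds x) ∧ x' = x ∧ P.SubPStationary S y x x' u' ∧
        P.StopTest S k y x x' u' ∧ P.subObj S y x x' u' ≤ P.subObj S y x x u))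

/-- `(x k, u k, y k)` is a sequence generated by the inexact Newton augmented Lagrangian method. -/
def IsINALMSequence (x : ℕ → Euc n) (u y : ℕ → Euc m) : Prop :=
  ∀ k, P.PrimalStep S k (x k) (u k) (y k) (x (k + 1)) (u (k + 1)) ∧
    y (k + 1) = y k + S.rho • P.resid (x (k + 1)) (u (k + 1))

/-- The projected critical cone `C*` at `(x*, u*, y*)`. -/
def criticalCone (us ys : Euc m) : Set (Euc n) :=
  {d | (∀ i, us i = 0 → 0 < ys i → P.mulA d i = 0) ∧
       (∀ i, us i = 0 → ys i = 0 → P.mulA d i ≤ 0)}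

/-- The second-order sufficient condition at `(x*, u*, y*)`. -/
def SOSC (xs : Euc n) (us ys : Euc m) : Prop :=
  ∀ d ∈ P.criticalCone us ys, d ≠ 0 → 0 < inner ℝ d (hessian P.f xs d)

/-- The Lyapunov values `V_k = V_{ρ,β}(x^k, u^k, y^k, x^{k-1})`; meant for `k ≥ 1`. -/
def lyapSeq (β : ℝ) (x : ℕ → Euc n) (u y : ℕ → Euc m) (k : ℕ) : ℝ :=
  P.lyap S.rho β (x k) (u k) (y k) (x (k - 1))

/-- `V_k - V_* ≤ c q^k` for all large `k`, where `V_* = V_{ρ,β}(x*, u*, y*, x*)`. -/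
def LyapunovRate (β : ℝ) (x : ℕ → Euc n) (u y : ℕ → Euc m) (xs : Euc n) (us ys : Euc m)
    (q : ℝ) : Prop :=
  ∃ kν : ℕ, 1 ≤ kν ∧ ∃ cν : ℝ, 0 < cν ∧
    ∀ k, kν ≤ k → P.lyapSeq S β x u y k - P.lyap S.rho β xs us ys xs ≤ cν * q ^ k

end ZeroOneCOP

end

noncomputable section

/-- The descent lemma for a function with a Lipschitz gradient. -/
theorem le_add_inner_add_sq_of_lipschitz_gradient {E : Type*} [NormedAddCommGroup E]
    [InnerProductSpace ℝ E] [CompleteSpace E] {f : E → ℝ} {g : E → E} {ℓ : ℝ}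
    (hf : ∀ x, HasGradientAt f (g x) x) (hg : ∀ x x', ‖g x - g x'‖ ≤ ℓ * ‖x - x'‖) (x d : E) :
    f (x + d) ≤ f x + inner ℝ (g x) d + ℓ / 2 * ‖d‖ ^ 2 := by
  have hder : ∀ s : ℝ, HasDerivAt
      (fun s : ℝ => f (x + s • d) - s * inner ℝ (g x) d - ℓ * ‖d‖ ^ 2 / 2 * s ^ 2)
      (inner ℝ (g (x + s • d)) d - 1 * inner ℝ (g x) d - ℓ * ‖d‖ ^ 2 / 2 * (2 * s)) s := by
    intro s
    have h1 : HasDerivAt (fun s : ℝ => x + s • d) d s := by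
      simpa using ((hasDerivAt_id s).smul_const d).const_add x
    have h2 : HasDerivAt (fun s : ℝ => f (x + s • d)) (inner ℝ (g (x + s • d)) d) s := by
      have h := (hf (x + s • d)).hasFDerivAt.comp_hasDerivAt s h1
      rwa [InnerProductSpace.toDual_apply_apply] at h
    refine (h2.sub ((hasDerivAt_id s).mul_const _)).sub ?_
    simpa using ((hasDerivAt_id s).pow 2).const_mul (ℓ * ‖d‖ ^ 2 / 2)
  have hanti : AntitoneOn
      (fun s : ℝ => f (x + s • d) - s * inner ℝ (g x) d - ℓ * ‖d‖ ^ 2 / 2 * s ^ 2)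
      (Set.Icc 0 1) := by
    refine antitoneOn_of_deriv_nonpos (convex_Icc 0 1)
      (fun s _ => (hder s).continuousAt.continuousWithinAt)
      (fun s _ => (hder s).differentiableAt.differentiableWithinAt) ?_
    intro s hs
    rw [interior_Icc] at hs
    rw [(hder s).deriv]
    have h1 : inner ℝ (g (x + s • d) - g x) d ≤ ℓ * ‖s • d‖ * ‖d‖ := by
      refine (real_inner_le_norm _ _).trans ?_
      gcongr
      simpa using hg (x + s • d) x
    rw [inner_sub_left, norm_smul, Real.norm_of_nonneg hs.1.le] at h1
    nlinarith
  have := hanti (Set.left_mem_Icc.2 zero_le_one) (Set.right_mem_Icc.2 zero_le_one) zero_le_one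
  simp only [one_smul, zero_smul, add_zero] at this
  linarith

theorem abs_apply_le_norm {m : ℕ} (w : Euc m) (i : Fin m) : |w i| ≤ ‖w‖ := by
  simpa using PiLp.norm_apply_le w i

theorem sum_sq_eq_norm_sq {m : ℕ} (w : Euc m) : ‖w‖ ^ 2 = ∑ i, (w i) ^ 2 := by
  simp [EuclideanSpace.norm_sq_eq]

theorem inner_eq_sum_mul {m : ℕ} (v w : Euc m) : inner ℝ v w = ∑ i, v i * w i := by
  simp [PiLp.inner_apply, mul_comm]

theorem zeroOneLoss_nonneg {m : ℕ} (u : Euc m) : 0 ≤ zeroOneLoss u := by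
  unfold zeroOneLoss; positivity

theorem zeroOneLoss_eq_sum {m : ℕ} (u : Euc m) :
    zeroOneLoss u = ∑ i, if 0 < u i then (1 : ℝ) else 0 := by
  simp [zeroOneLoss]

theorem zeroOneLoss_le_of_pos_imp {m : ℕ} {u v : Euc m} (h : ∀ i, 0 < u i → 0 < v i) :
    zeroOneLoss u ≤ zeroOneLoss v := by
  unfold zeroOneLoss
  exact_mod_cast Finset.card_le_card fun i => by simpa using h i

theorem zeroOneLoss_le_of_lt_add_one {m : ℕ} {u v : Euc m}
    (h : zeroOneLoss u < zeroOneLoss v + 1) : zeroOneLoss u ≤ zeroOneLoss v := by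
  unfold zeroOneLoss at *
  exact_mod_cast Nat.lt_succ_iff.1 (by exact_mod_cast h)

theorem moreauEnv_le {m : ℕ} {ψ : Euc m → ℝ} (hψ : ∀ z, 0 ≤ ψ z) (v z : Euc m) :
    moreauEnv ψ v ≤ ψ z + (1 / 2) * ‖z - v‖ ^ 2 :=
  ciInf_le ⟨0, by rintro _ ⟨w, rfl⟩; have := hψ w; dsimp only; positivity⟩ z

namespace ZeroOneCOP
variable {n m : ℕ} (P : ZeroOneCOP n m) (S : NALMParams)

/-- `x ↦ A x` as a continuous linear map. -/
def mulAL : Euc n →L[ℝ] Euc m := LinearMap.toContinuousLinearMap (Matrix.toEuclideanLin P.A)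

/-- `y ↦ Aᵀ y` as a continuous linear map. -/
def mulATL : Euc m →L[ℝ] Euc n :=
  LinearMap.toContinuousLinearMap (Matrix.toEuclideanLin P.A.transpose)

theorem inner_mulAL (x : Euc n) (y : Euc m) : inner ℝ y (P.mulAL x) = inner ℝ (P.mulATL y) x := by
  have h := Matrix.toEuclideanLin_conjTranspose_eq_adjoint P.A
  rw [Matrix.conjTranspose_eq_transpose_of_trivial] at h
  change inner ℝ y (Matrix.toEuclideanLin P.A x)
    = inner ℝ (Matrix.toEuclideanLin P.A.transpose y) x
  rw [h, LinearMap.adjoint_inner_left]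

theorem gamma_mul_norm_le {γ : ℝ}
    (hγA : IsLeast (spectrum ℝ (P.A * P.A.transpose)) (γ ^ 2)) (y : Euc m) :
    γ * ‖y‖ ≤ ‖P.mulATL y‖ := by
  have hpsd : (P.A * P.A.transpose - algebraMap ℝ (Matrix (Fin m) (Fin m) ℝ) (γ ^ 2)).PosSemidef := by
    rw [Matrix.posSemidef_iff_isHermitian_and_spectrum_nonneg]
    constructor
    · have h1 : (P.A * P.A.transpose).IsHermitian := by
        simpa using Matrix.isHermitian_mul_conjTranspose_self P.A
      refine h1.sub ?_
      rw [Algebra.algebraMap_eq_smul_one, Matrix.IsHermitian]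
      simp
    · rw [← spectrum.sub_singleton_eq]
      rintro _ ⟨a, ha, _, rfl, rfl⟩
      have := hγA.2 ha
      simpa using this
  have h2 := hpsd.dotProduct_mulVec_nonneg (y : Fin m → ℝ)
  have h3 : ‖P.mulATL y‖ ^ 2 = dotProduct (y : Fin m → ℝ) ((P.A * P.A.transpose).mulVec y) := by
    rw [← real_inner_self_eq_norm_sq, ← inner_mulAL, inner_eq_sum_mul]
    simp [dotProduct, mulAL, mulATL, Matrix.toLpLin_apply, ← Matrix.mulVec_mulVec]
  have h4 : dotProduct (y : Fin m → ℝ) y = ‖y‖ ^ 2 := by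
    rw [sum_sq_eq_norm_sq]; simp [dotProduct, sq]
  simp only [star_trivial, Matrix.sub_mulVec, dotProduct_sub, Algebra.algebraMap_eq_smul_one,
    Matrix.smul_mulVec, Matrix.one_mulVec, dotProduct_smul, smul_eq_mul, h4, ← h3] at h2
  refine abs_le_of_sq_le_sq' ?_ (norm_nonneg _) |>.2
  linarith [mul_pow γ ‖y‖ 2]

theorem resid_eq (x : Euc n) (u : Euc m) : P.resid x u = P.mulAL x + P.b - u := rfl

variable {P S}

theorem hasGradientAt_subSmooth_left (hf : Differentiable ℝ P.f) (y : Euc m) (v : Euc n)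
    (x : Euc n) (u : Euc m) :
    HasGradientAt (fun x' => P.subSmooth S y v x' u)
      (gradient P.f x + P.mulATL (y + S.rho • P.resid x u) + S.mu • (x - v)) x := by
  have h1 := (hf x).hasGradientAt.hasFDerivAt
  have hr : HasFDerivAt (fun x' => P.resid x' u) P.mulAL x :=
    (P.mulAL.hasFDerivAt.add_const _).sub_const _
  have h2 : HasFDerivAt (fun x' => inner ℝ y (P.resid x' u)) ((innerSL ℝ y).comp P.mulAL) x :=
    (innerSL ℝ y).hasFDerivAt.comp x hr
  have h3 := (hr.norm_sq).const_mul (S.rho / 2)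
  have h4 := (((hasFDerivAt_id x).sub_const v).norm_sq).const_mul (S.mu / 2)
  rw [hasGradientAt_iff_hasFDerivAt]
  refine (((h1.add h2).add h3).add h4).congr_fderiv ?_
  ext d
  simp [← inner_mulAL]
  ring

theorem hasGradientAt_subSmooth_right (y : Euc m) (v : Euc n) (x : Euc n) (u : Euc m) :
    HasGradientAt (fun u' => P.subSmooth S y v x u') (-(y + S.rho • P.resid x u)) u := by
  have hr : HasFDerivAt (fun u' => P.resid x u') (-ContinuousLinearMap.id ℝ (Euc m)) u :=
    (hasFDerivAt_id u).const_sub _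
  have h2 : HasFDerivAt (fun u' => inner ℝ y (P.resid x u'))
      ((innerSL ℝ y).comp (-ContinuousLinearMap.id ℝ (Euc m))) u :=
    (innerSL ℝ y).hasFDerivAt.comp u hr
  have h3 := (hr.norm_sq).const_mul (S.rho / 2)
  rw [hasGradientAt_iff_hasFDerivAt]
  refine (((h2.const_add (P.f x)).add h3).add_const (S.mu / 2 * ‖x - v‖ ^ 2)).congr_fderiv ?_
  ext d
  simp
  ring

theorem gradX_eq (hf : Differentiable ℝ P.f) (y : Euc m) (v : Euc n) (x : Euc n) (u : Euc m) :
    P.gradX S y v x u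
      = gradient P.f x + P.mulATL (y + S.rho • P.resid x u) + S.mu • (x - v) :=
  (hasGradientAt_subSmooth_left hf y v x u).gradient

theorem gradU_eq (y : Euc m) (v : Euc n) (x : Euc n) (u : Euc m) :
    P.gradU S y v x u = -(y + S.rho • P.resid x u) :=
  (hasGradientAt_subSmooth_right y v x u).gradient

end ZeroOneCOP
end

noncomputable section
namespace ZeroOneCOP
variable {n m : ℕ} {P : ZeroOneCOP n m} {S : NALMParams}

theorem subSmooth_add_right (y : Euc m) (v : Euc n) (x : Euc n) (u d : Euc m) :
    P.subSmooth S y v x (u + d)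
      = P.subSmooth S y v x u + inner ℝ (P.gradU S y v x u) d + S.rho / 2 * ‖d‖ ^ 2 := by
  have h : P.resid x (u + d) = P.resid x u - d := by simp only [resid_eq]; abel
  simp only [subSmooth, gradU_eq, h, inner_sub_right, inner_neg_left, inner_add_left,
    inner_smul_left, norm_sub_sq_real]
  simp
  ring

theorem IsGradLipschitzModulus.rho_mul_norm_le {ℓ : ℝ} (h : P.IsGradLipschitzModulus S ℓ)
    (d : Euc m) : S.rho * ‖d‖ ≤ ℓ * ‖d‖ := by
  have h1 := h 0 0 0 0 0 d
  simp only [gradU_eq, resid_eq] at h1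
  have h2 : ‖S.rho • d‖ ≤ ℓ * ‖d‖ := by
    refine le_trans (Real.le_sqrt_of_sq_le ?_) (h1.trans_eq (by simp))
    refine le_add_of_nonneg_of_le (sq_nonneg _) (le_of_eq ?_)
    rw [← norm_neg]
    congr 2
    module
  rw [norm_smul, Real.norm_eq_abs] at h2
  exact (mul_le_mul_of_nonneg_right (le_abs_self _) (norm_nonneg _)).trans h2

theorem IsGradLipschitzModulus.gradX_lipschitz {ℓ : ℝ} (h : P.IsGradLipschitzModulus S ℓ)
    (y : Euc m) (v : Euc n) (u : Euc m) (x x' : Euc n) :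
    ‖P.gradX S y v x u - P.gradX S y v x' u‖ ≤ ℓ * ‖x - x'‖ := by
  refine le_trans (Real.le_sqrt_of_sq_le ?_) ((h y v x x' u u).trans_eq (by simp))
  exact le_add_of_nonneg_right (sq_nonneg _)

/-- The gradient half-step in `u` is a proximal step. -/
theorem halfU_mem_proxSet (hα : 0 < S.alpha) (hlam : 0 < P.lam) (y : Euc m) (v : Euc n)
    (x : Euc n) (u : Euc m) :
    P.halfU S y v x u ∈ proxSet (fun w => S.alpha * P.lam * zeroOneLoss w)
      (u - S.alpha • P.gradU S y v x u) := by
  intro z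
  have hτ : 0 < S.alpha * P.lam := mul_pos hα hlam
  set w := u - S.alpha • P.gradU S y v x u with hw
  simp only [sum_sq_eq_norm_sq, zeroOneLoss_eq_sum, Finset.mul_sum, ← Finset.sum_add_distrib]
  refine Finset.sum_le_sum fun i _ => ?_
  have hsq : Real.sqrt (2 * S.alpha * P.lam) ^ 2 = 2 * (S.alpha * P.lam) := by
    rw [Real.sq_sqrt (by positivity)]; ring
  have hs0 := Real.sqrt_nonneg (2 * S.alpha * P.lam)
  have hi : P.halfU S y v x u i = if i ∈ P.activeSet S y v x u then 0 else w i := by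
    by_cases hi : i ∈ P.activeSet S y v x u <;> simp [halfU, restrictTo, hi, hw]
  have hmem : i ∈ P.activeSet S y v x u ↔ 0 ≤ w i ∧ w i < Real.sqrt (2 * S.alpha * P.lam) := by
    simp [activeSet, hw]
  simp only [PiLp.sub_apply, hi]
  split_ifs with h1 h2 h3 h3 h2 h3 h3
  · exact absurd h2 (lt_irrefl _)
  · exact absurd h2 (lt_irrefl _)
  · rw [hmem] at h1
    nlinarith [sq_nonneg (z i - w i)]
  · rw [hmem] at h1
    nlinarith
  · nlinarith [sq_nonneg (z i - w i)]
  · rw [hmem, not_and_or, not_le, not_lt] at h1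
    have : Real.sqrt (2 * S.alpha * P.lam) ≤ w i := by
      rcases h1 with h1 | h1
      · linarith
      · exact h1
    nlinarith
  · nlinarith [sq_nonneg (z i - w i)]
  · nlinarith [sq_nonneg (z i - w i)]

theorem subObj_halfU_le {ℓ : ℝ} (hℓ : 0 < ℓ) (hlip : P.IsGradLipschitzModulus S ℓ)
    (hα : 0 < S.alpha) (hα' : S.alpha < 1 / ℓ) (hlam : 0 < P.lam) (y : Euc m) (v : Euc n)
    (x : Euc n) (u : Euc m) :
    P.subObj S y v x (P.halfU S y v x u) ≤ P.subObj S y v x u := by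
  have h1 := halfU_mem_proxSet hα hlam y v x u u
  set d := P.halfU S y v x u - u with hd
  have hu : P.halfU S y v x u = u + d := by rw [hd]; abel
  have e1 : P.halfU S y v x u - (u - S.alpha • P.gradU S y v x u)
      = d + S.alpha • P.gradU S y v x u := by rw [hd]; abel
  have e2 : u - (u - S.alpha • P.gradU S y v x u) = S.alpha • P.gradU S y v x u := by abel
  dsimp only at h1
  rw [e1, e2, norm_add_sq_real, inner_smul_right, real_inner_comm] at h1
  have h2 := hlip.rho_mul_norm_le d
  have h3 : S.rho * ‖d‖ ^ 2 ≤ ℓ * ‖d‖ ^ 2 := by nlinarith [norm_nonneg d]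
  have h4 : S.alpha * ℓ ≤ 1 := by
    rw [lt_div_iff₀ hℓ] at hα'; exact hα'.le
  have h5 : S.alpha * (S.rho * ‖d‖ ^ 2) ≤ ‖d‖ ^ 2 := by
    calc S.alpha * (S.rho * ‖d‖ ^ 2) ≤ S.alpha * (ℓ * ‖d‖ ^ 2) := by gcongr
      _ = (S.alpha * ℓ) * ‖d‖ ^ 2 := by ring
      _ ≤ 1 * ‖d‖ ^ 2 := by gcongr
      _ = _ := one_mul _
  have h6 : P.subSmooth S y v x (P.halfU S y v x u)
      = P.subSmooth S y v x u + inner ℝ (P.gradU S y v x u) d + S.rho / 2 * ‖d‖ ^ 2 := by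
    rw [hu]; exact subSmooth_add_right y v x u d
  refine le_of_mul_le_mul_left ?_ hα
  unfold subObj
  rw [h6]
  nlinarith

theorem subObj_gradStep_le (hf : Differentiable ℝ P.f) {ℓ : ℝ} (hℓ : 0 < ℓ)
    (hlip : P.IsGradLipschitzModulus S ℓ) (ht : 0 < S.t) (ht' : S.t < 2 / ℓ) (y : Euc m)
    (v : Euc n) (x : Euc n) (u : Euc m) :
    P.subObj S y v (x - S.t • P.gradX S y v x u) u ≤ P.subObj S y v x u := by
  have hg : ∀ x, HasGradientAt (fun x' => P.subSmooth S y v x' u) (P.gradX S y v x u) x := by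
    intro x
    rw [gradX_eq hf]
    exact hasGradientAt_subSmooth_left hf y v x u
  have h := le_add_inner_add_sq_of_lipschitz_gradient hg (hlip.gradX_lipschitz y v u) x
    (-(S.t • P.gradX S y v x u))
  rw [inner_neg_right, inner_smul_right, real_inner_self_eq_norm_sq, norm_neg, norm_smul,
    Real.norm_of_nonneg ht.le, ← sub_eq_add_neg, mul_pow] at h
  have h1 : S.t * ℓ ≤ 2 := by rw [lt_div_iff₀ hℓ] at ht'; exact ht'.le
  have h2 : 0 ≤ S.t * ‖P.gradX S y v x u‖ ^ 2 := by positivity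
  unfold subObj
  nlinarith

theorem GSNewtonStep.subObj_le (hf : Differentiable ℝ P.f) {ℓ : ℝ} (hℓ : 0 < ℓ)
    (hlip : P.IsGradLipschitzModulus S ℓ) (hα : 0 < S.alpha) (hα' : S.alpha < 1 / ℓ)
    (hlam : 0 < P.lam) (ht : 0 < S.t) (ht' : S.t < 2 / ℓ) (hμ : S.sigma < S.mu) {y : Euc m}
    {v x x' : Euc n} {u u' : Euc m} (h : P.GSNewtonStep S y v x u x' u') :
    P.subObj S y v x' u' ≤ P.subObj S y v x u := by
  have h1 : P.subObj S y v (P.halfX S y v x u) (P.halfU S y v x u) ≤ P.subObj S y v x u :=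
    (subObj_gradStep_le hf hℓ hlip ht ht' y v x _).trans
      (subObj_halfU_le hℓ hlip hα hα' hlam y v x u)
  obtain ⟨xt, ut, -, ⟨h2, rfl, rfl⟩ | ⟨-, rfl, rfl⟩⟩ := h
  · refine le_trans ?_ h1
    have : 0 ≤ (S.mu - S.sigma) / 4 *
        (‖x' - P.halfX S y v x u‖ ^ 2 + ‖u' - P.halfU S y v x u‖ ^ 2) :=
      mul_nonneg (by linarith) (by positivity)
    linarith
  · exact h1

theorem PrimalStep.stopTest {k : ℕ} {x x' : Euc n} {u u' y : Euc m}
    (h : P.PrimalStep S k x u y x' u') : P.StopTest S k y x x' u' := by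
  obtain ⟨X, U, -, ⟨j, hj, rfl, rfl⟩ | ⟨-, -, -, hj, -⟩⟩ := h <;> exact hj

theorem PrimalStep.subObj_le (hf : Differentiable ℝ P.f) {ℓ : ℝ} (hℓ : 0 < ℓ)
    (hlip : P.IsGradLipschitzModulus S ℓ) (hα : 0 < S.alpha) (hα' : S.alpha < 1 / ℓ)
    (hlam : 0 < P.lam) (ht : 0 < S.t) (ht' : S.t < 2 / ℓ) (hμ : S.sigma < S.mu) {k : ℕ}
    {x x' : Euc n} {u u' y : Euc m} (h : P.PrimalStep S k x u y x' u') :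
    P.subObj S y x x' u' ≤ P.subObj S y x x u := by
  obtain ⟨X, U, ⟨hX, hU, hstep⟩, ⟨j, -, rfl, rfl⟩ | ⟨-, rfl, -, -, hj⟩⟩ := h
  · induction j with
    | zero => rw [hX, hU]
    | succ j ih =>
      exact ((hstep j).subObj_le hf hℓ hlip hα hα' hlam ht ht' hμ).trans ih
  · exact hj

end ZeroOneCOP
end

noncomputable section
namespace ZeroOneCOP
variable {n m : ℕ} {P : ZeroOneCOP n m} {S : NALMParams}

/-- The properties of the iterates that the convergence analysis uses: approximate stationarity,
approximate complementarity, approximate proximality, the multiplier update, and the decrease of the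
augmented Lagrangian in the primal step. -/
structure IsApproxKKTSequence (P : ZeroOneCOP n m) (S : NALMParams) (x : ℕ → Euc n)
    (u y : ℕ → Euc m) : Prop where
  stat : ∀ k, ‖gradient P.f (x (k + 1)) + P.mulATL (y (k + 1)) + S.mu • (x (k + 1) - x k)‖
    ≤ S.c₁ * ‖x (k + 1) - x k‖
  compl : ∀ k i, (|u (k + 1) i| ≤ S.c₂ * ‖x (k + 1) - x k‖ ^ 2) ∨
    (S.alpha * |y (k + 1) i| ≤ S.c₂ * ‖x (k + 1) - x k‖ ^ 2 ∧
      (0 ≤ u (k + 1) i + S.alpha * y (k + 1) i →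
        Real.sqrt (2 * S.alpha * P.lam) ≤ u (k + 1) i + S.alpha * y (k + 1) i))
  prox : ∀ k z, S.alpha ^ 2 / 2 * ‖y (k + 1)‖ ^ 2 + S.alpha * P.lam * zeroOneLoss (u (k + 1))
    ≤ S.alpha * P.lam * zeroOneLoss z
      + (1 / 2) * ‖z - (u (k + 1) + S.alpha • y (k + 1))‖ ^ 2 + S.eps k
  dual : ∀ k, y (k + 1) = y k + S.rho • P.resid (x (k + 1)) (u (k + 1))
  lag : ∀ k, P.augLag S.rho (x (k + 1)) (u (k + 1)) (y k) + S.mu / 2 * ‖x (k + 1) - x k‖ ^ 2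
    ≤ P.augLag S.rho (x k) (u k) (y k)

theorem IsINALMSequence.isApproxKKTSequence (hf : Differentiable ℝ P.f) {ℓ : ℝ} (hℓ : 0 < ℓ)
    (hlip : P.IsGradLipschitzModulus S ℓ) (hα : 0 < S.alpha) (hα' : S.alpha < 1 / ℓ)
    (hlam : 0 < P.lam) (ht : 0 < S.t) (ht' : S.t < 2 / ℓ) (hμ : S.sigma < S.mu)
    {x : ℕ → Euc n} {u y : ℕ → Euc m} (h : P.IsINALMSequence S x u y) :
    P.IsApproxKKTSequence S x u y := by
  have hgu : ∀ k, P.gradU S (y k) (x k) (x (k + 1)) (u (k + 1)) = -y (k + 1) := by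
    intro k
    rw [gradU_eq, (h k).2]
  have hw : ∀ k, u (k + 1) - S.alpha • P.gradU S (y k) (x k) (x (k + 1)) (u (k + 1))
      = u (k + 1) + S.alpha • y (k + 1) := by
    intro k
    rw [hgu, smul_neg, sub_neg_eq_add]
  refine ⟨fun k => ?_, fun k i => ?_, fun k z => ?_, fun k => (h k).2, fun k => ?_⟩
  · have h1 := (h k).1.stopTest.1
    rwa [res₁, gradX_eq hf, ← (h k).2] at h1
  · have h1 := (abs_apply_le_norm _ i).trans (h k).1.stopTest.2.1
    have hmem : i ∈ P.activeSet S (y k) (x k) (x (k + 1)) (u (k + 1)) ↔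
        0 ≤ u (k + 1) i + S.alpha * y (k + 1) i ∧
          u (k + 1) i + S.alpha * y (k + 1) i < Real.sqrt (2 * S.alpha * P.lam) := by
      simp [activeSet, hw]
    by_cases hi : i ∈ P.activeSet S (y k) (x k) (x (k + 1)) (u (k + 1))
    · left
      simpa [restrictTo, hi] using h1
    · right
      simp only [restrictTo, hi, PiLp.add_apply, if_false, Finset.mem_compl, not_false_eq_true,
        if_true, zero_add, hgu, PiLp.smul_apply, PiLp.neg_apply, smul_eq_mul, abs_mul, abs_neg,
        abs_of_pos hα] at h1
      refine ⟨h1, fun h0 => ?_⟩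
      rw [hmem, not_and, not_lt] at hi
      exact hi h0
  · have h1 := (h k).1.stopTest.2.2
    rw [res₃, hw, hgu, norm_neg] at h1
    have h2 := moreauEnv_le (ψ := fun w => S.alpha * P.lam * zeroOneLoss w)
      (fun w => mul_nonneg (mul_pos hα hlam).le (zeroOneLoss_nonneg w))
      (u (k + 1) + S.alpha • y (k + 1)) z
    linarith
  · have h1 := (h k).1.subObj_le hf hℓ hlip hα hα' hlam ht ht' hμ
    simp only [subObj, subSmooth, sub_self, norm_zero] at h1
    simp only [augLag]
    linarith


theorem IsApproxKKTSequence.dual_diff_le {x : ℕ → Euc n} {u y : ℕ → Euc m}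
    (h : P.IsApproxKKTSequence S x u y) {ℓ γ c₃ c₄ : ℝ}
    (hgrad : ∀ x x' : Euc n, ‖gradient P.f x - gradient P.f x'‖ ≤ ℓ * ‖x - x'‖) (hγ : 0 < γ)
    (hγA : ∀ y, γ * ‖y‖ ≤ ‖P.mulATL y‖) (hμ : 0 < S.mu) (hc₃ : c₃ = (S.mu + ℓ + S.c₁) / γ)
    (hc₄ : c₄ = (S.mu + S.c₁) / γ) (k : ℕ) :
    ‖y (k + 2) - y (k + 1)‖ ≤ c₃ * ‖x (k + 2) - x (k + 1)‖ + c₄ * ‖x (k + 1) - x k‖ := by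
  have h1 := hγA (y (k + 2) - y (k + 1))
  have h2 : P.mulATL (y (k + 2) - y (k + 1))
      = ((gradient P.f (x (k + 2)) + P.mulATL (y (k + 2)) + S.mu • (x (k + 2) - x (k + 1)))
        - (gradient P.f (x (k + 1)) + P.mulATL (y (k + 1)) + S.mu • (x (k + 1) - x k)))
        - (gradient P.f (x (k + 2)) - gradient P.f (x (k + 1)))
        - S.mu • (x (k + 2) - x (k + 1)) + S.mu • (x (k + 1) - x k) := by
    rw [map_sub]; abel
  rw [h2] at h1
  have h3 := norm_add_le (((gradient P.f (x (k + 2)) + P.mulATL (y (k + 2))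
      + S.mu • (x (k + 2) - x (k + 1)))
        - (gradient P.f (x (k + 1)) + P.mulATL (y (k + 1)) + S.mu • (x (k + 1) - x k)))
        - (gradient P.f (x (k + 2)) - gradient P.f (x (k + 1)))
        - S.mu • (x (k + 2) - x (k + 1))) (S.mu • (x (k + 1) - x k))
  have h4 := norm_sub_le (((gradient P.f (x (k + 2)) + P.mulATL (y (k + 2))
      + S.mu • (x (k + 2) - x (k + 1)))
        - (gradient P.f (x (k + 1)) + P.mulATL (y (k + 1)) + S.mu • (x (k + 1) - x k)))
        - (gradient P.f (x (k + 2)) - gradient P.f (x (k + 1))))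
        (S.mu • (x (k + 2) - x (k + 1)))
  have h5 := norm_sub_le ((gradient P.f (x (k + 2)) + P.mulATL (y (k + 2))
      + S.mu • (x (k + 2) - x (k + 1)))
        - (gradient P.f (x (k + 1)) + P.mulATL (y (k + 1)) + S.mu • (x (k + 1) - x k)))
        (gradient P.f (x (k + 2)) - gradient P.f (x (k + 1)))
  have h6 := norm_sub_le (gradient P.f (x (k + 2)) + P.mulATL (y (k + 2))
      + S.mu • (x (k + 2) - x (k + 1)))
        (gradient P.f (x (k + 1)) + P.mulATL (y (k + 1)) + S.mu • (x (k + 1) - x k))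
  have h7 := h.stat k
  have h8 := h.stat (k + 1)
  have h9 := hgrad (x (k + 2)) (x (k + 1))
  rw [norm_smul, Real.norm_of_nonneg hμ.le] at h3 h4
  have h10 : γ * ‖y (k + 2) - y (k + 1)‖ ≤
      (S.mu + ℓ + S.c₁) * ‖x (k + 2) - x (k + 1)‖ + (S.mu + S.c₁) * ‖x (k + 1) - x k‖ := by
    simp only [add_assoc, Nat.reduceAdd] at *
    linarith
  rw [hc₃, hc₄, div_mul_eq_mul_div, div_mul_eq_mul_div, ← add_div, le_div_iff₀ hγ]
  linarith

theorem augLag_dual_update {x : Euc n} {u y y' : Euc m} (hρ : 0 < S.rho)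
    (h : y' = y + S.rho • P.resid x u) :
    P.augLag S.rho x u y' = P.augLag S.rho x u y + ‖y' - y‖ ^ 2 / S.rho := by
  have h1 : y' - y = S.rho • P.resid x u := by rw [h]; abel
  rw [h1, norm_smul, Real.norm_of_nonneg hρ.le, augLag, augLag, h, inner_add_left,
    inner_smul_left, real_inner_self_eq_norm_sq]
  simp only [conj_trivial]
  field_simp
  ring

theorem IsApproxKKTSequence.lyapSeq_succ_le {x : ℕ → Euc n} {u y : ℕ → Euc m}
    (h : P.IsApproxKKTSequence S x u y) {c₃ c₄ β : ℝ} (hμ : 0 < S.mu) (hρ0 : 0 < S.rho)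
    (hdiff : ∀ k, ‖y (k + 2) - y (k + 1)‖
      ≤ c₃ * ‖x (k + 2) - x (k + 1)‖ + c₄ * ‖x (k + 1) - x k‖)
    (hρ : 8 * (c₃ ^ 2 + c₄ ^ 2) / S.mu < S.rho) (hβ : β = 4 * c₄ ^ 2 / S.rho) (k : ℕ) :
    P.lyapSeq S β x u y (k + 2) + S.mu / 4 * ‖x (k + 2) - x (k + 1)‖ ^ 2
      ≤ P.lyapSeq S β x u y (k + 1) := by
  have h1 := h.lag (k + 1)
  have h2 := augLag_dual_update hρ0 (h.dual (k + 1))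
  have h3 : ‖y (k + 2) - y (k + 1)‖ ^ 2 ≤ 2 * c₃ ^ 2 * ‖x (k + 2) - x (k + 1)‖ ^ 2
      + 2 * c₄ ^ 2 * ‖x (k + 1) - x k‖ ^ 2 := by
    have := pow_le_pow_left₀ (norm_nonneg _) (hdiff k) 2
    nlinarith [sq_nonneg (c₃ * ‖x (k + 2) - x (k + 1)‖ - c₄ * ‖x (k + 1) - x k‖)]
  simp only [lyapSeq, lyap, add_tsub_cancel_right, show k + 2 - 1 = k + 1 from rfl] at *
  simp only [add_assoc, Nat.reduceAdd] at *
  rw [h2, hβ]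
  rw [div_lt_iff₀ hμ] at hρ
  have h4 : ‖y (k + 2) - y (k + 1)‖ ^ 2 / S.rho
      ≤ (2 * c₃ ^ 2 * ‖x (k + 2) - x (k + 1)‖ ^ 2 + 2 * c₄ ^ 2 * ‖x (k + 1) - x k‖ ^ 2) / S.rho := by
    gcongr
  have h5 : (2 * c₃ ^ 2 + 2 * c₄ ^ 2) / S.rho ≤ S.mu / 4 := by
    rw [div_le_iff₀ hρ0]; linarith
  have h6 := mul_le_mul_of_nonneg_right h5 (sq_nonneg ‖x (k + 2) - x (k + 1)‖)
  have h7 : (2 * c₃ ^ 2 * ‖x (k + 2) - x (k + 1)‖ ^ 2 + 2 * c₄ ^ 2 * ‖x (k + 1) - x k‖ ^ 2) / S.rho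
      + 4 * c₄ ^ 2 / S.rho / 2 * ‖x (k + 2) - x (k + 1)‖ ^ 2
      = (2 * c₃ ^ 2 + 2 * c₄ ^ 2) / S.rho * ‖x (k + 2) - x (k + 1)‖ ^ 2
      + 4 * c₄ ^ 2 / S.rho / 2 * ‖x (k + 1) - x k‖ ^ 2 := by ring
  linarith

end ZeroOneCOP
end

noncomputable section

/-- A continuous function that is positive on the zero set of a nonnegative one, over a compact set,
is made uniformly positive by a penalty. -/
theorem IsCompact.exists_penalty {E : Type*} [TopologicalSpace E] {K : Set E} (hK : IsCompact K)
    {q p : E → ℝ} (hq : Continuous q) (hp : Continuous p) (hp0 : ∀ d, 0 ≤ p d)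
    (hpos : ∀ d ∈ K, p d = 0 → 0 < q d) :
    ∃ κ M : ℝ, 0 < κ ∧ 0 ≤ M ∧ ∀ d ∈ K, κ ≤ q d + M * p d := by
  have hcover : K ⊆ ⋃ N : ℕ, {d | 0 < q d + N * p d} := by
    intro d hd
    rw [Set.mem_iUnion]
    rcases (hp0 d).eq_or_lt with h | h
    · exact ⟨0, by simpa using hpos d hd h.symm⟩
    · obtain ⟨N, hN⟩ := exists_nat_gt (-q d / p d)
      rw [div_lt_iff₀ h] at hN
      exact ⟨N, by simp only [Set.mem_ofPred_eq]; linarith⟩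
  obtain ⟨N, hN⟩ := hK.elim_directed_cover (fun N : ℕ => {d | 0 < q d + N * p d})
    (fun N => isOpen_lt continuous_const (hq.add (continuous_const.mul hp))) hcover
    (directed_of_isDirected_le fun a b hab d (hd : 0 < q d + a * p d) => by
      have : (a : ℝ) * p d ≤ b * p d := mul_le_mul_of_nonneg_right (by exact_mod_cast hab) (hp0 d)
      change 0 < q d + b * p d
      linarith)
  obtain ⟨κ, hκ, h⟩ := hK.exists_forall_le' (hq.add (continuous_const.mul hp)).continuousOn hN
  exact ⟨κ, N, hκ, N.cast_nonneg, h⟩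

/-- Linear convergence of a nonincreasing sequence that dominates the squared increments of `x` and
is, while `x` is near the cluster point `xs`, controlled by two of them. -/
theorem exists_linear_rate_of_local_bound {E : Type*} [NormedAddCommGroup E] {x : ℕ → E} {xs : E}
    {a : ℕ → ℝ} {c C δ : ℝ} {k₀ : ℕ} (hc : 0 < c) (hC : 0 < C) (hδ : 0 < δ)
    (hdec : ∀ k, k₀ ≤ k → a (k + 1) + c * ‖x (k + 1) - x k‖ ^ 2 ≤ a k)
    (ha0 : ∀ k, k₀ ≤ k → 0 ≤ a k)
    (ha : Filter.Tendsto a Filter.atTop (nhds 0))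
    (hloc : ∀ k, k₀ ≤ k → ‖x (k + 2) - xs‖ ≤ δ →
      a (k + 2) ≤ C * (‖x (k + 2) - x (k + 1)‖ ^ 2 + ‖x (k + 1) - x k‖ ^ 2))
    (hcl : ∃ᶠ k in Filter.atTop, ‖x k - xs‖ < δ / 2) :
    ∃ q : ℝ, 0 < q ∧ q < 1 ∧ ∃ N : ℕ, 1 ≤ N ∧ ∃ B : ℝ, 0 < B ∧ ∀ k, N ≤ k → a k ≤ B * q ^ k := by
  set θ : ℝ := C / (c + C) with hθ
  have hθ0 : 0 < θ := by positivity
  have hθ1 : θ < 1 := by rw [hθ, div_lt_one (by positivity)]; linarith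
  set s : ℝ := Real.sqrt (Real.sqrt θ) with hs
  have hs0 : 0 < s := Real.sqrt_pos.2 (Real.sqrt_pos.2 hθ0)
  have hs1 : s < 1 := by
    rw [hs, Real.sqrt_lt' one_pos, one_pow, Real.sqrt_lt' one_pos, one_pow]; exact hθ1
  have hs4 : s ^ 4 = θ := by
    have h1 : s ^ 4 = (s ^ 2) ^ 2 := by ring
    rw [h1, hs, Real.sq_sqrt (Real.sqrt_nonneg _), Real.sq_sqrt hθ0.le]
  set R : ℝ := δ / 2 * (1 - s) with hR
  have hR0 : 0 < R := mul_pos (by positivity) (by linarith)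
  set B : ℝ := c * R ^ 2 with hB
  have hB0 : 0 < B := by positivity
  obtain ⟨j₀, hj₀x, hj₀a, hj₀⟩ := (hcl.and_eventually
    ((ha.eventually_lt_const (show (0 : ℝ) < B * s ^ 2 by positivity)).and
      (Filter.eventually_ge_atTop (max k₀ 1)))).exists
  have hk : ∀ j, k₀ ≤ j₀ + j := fun j => ((le_max_left _ _).trans hj₀).trans (Nat.le_add_right _ _)
  have hmove : ∀ j, ‖x (j₀ + j) - xs‖ ≤ δ / 2 + δ / 2 * (1 - s ^ j) →
      a (j₀ + j) ≤ B * s ^ (2 * j) →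
      ‖x (j₀ + (j + 1)) - xs‖ ≤ δ / 2 + δ / 2 * (1 - s ^ (j + 1)) := by
    intro j h1 h2
    have h3 : ‖x (j₀ + (j + 1)) - x (j₀ + j)‖ ≤ R * s ^ j := by
      refine abs_le_of_sq_le_sq' ?_ (by positivity) |>.2
      refine le_of_mul_le_mul_left ?_ hc
      have h4 := hdec (j₀ + j) (hk j)
      have h5 := ha0 (j₀ + (j + 1)) (hk _)
      have h6 : c * (R * s ^ j) ^ 2 = B * s ^ (2 * j) := by rw [hB]; ring
      rw [← add_assoc] at h5 ⊢
      linarith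
    calc ‖x (j₀ + (j + 1)) - xs‖
        = ‖(x (j₀ + (j + 1)) - x (j₀ + j)) + (x (j₀ + j) - xs)‖ := by congr 1; abel
      _ ≤ ‖x (j₀ + (j + 1)) - x (j₀ + j)‖ + ‖x (j₀ + j) - xs‖ := norm_add_le _ _
      _ ≤ R * s ^ j + (δ / 2 + δ / 2 * (1 - s ^ j)) := add_le_add h3 h1
      _ = _ := by rw [hR]; ring
  have hball : ∀ j, δ / 2 + δ / 2 * (1 - s ^ j) ≤ δ := by
    intro j
    have : 0 ≤ δ / 2 * s ^ j := by positivity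
    linarith
  have key : ∀ j, (‖x (j₀ + j) - xs‖ ≤ δ / 2 + δ / 2 * (1 - s ^ j) ∧ a (j₀ + j) ≤ B * s ^ (2 * j)) ∧
      (‖x (j₀ + (j + 1)) - xs‖ ≤ δ / 2 + δ / 2 * (1 - s ^ (j + 1)) ∧
        a (j₀ + (j + 1)) ≤ B * s ^ (2 * (j + 1))) := by
    intro j
    induction j with
    | zero =>
      have h1 : ‖x (j₀ + 0) - xs‖ ≤ δ / 2 + δ / 2 * (1 - s ^ 0) := by simpa using hj₀x.le
      have h2 : a (j₀ + 0) ≤ B * s ^ (2 * 0) := by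
        have : s ^ 2 ≤ 1 := pow_le_one₀ hs0.le hs1.le
        have : B * s ^ 2 ≤ B := mul_le_of_le_one_right hB0.le this
        simpa using hj₀a.le.trans this
      refine ⟨⟨h1, h2⟩, hmove 0 h1 h2, ?_⟩
      have h3 := hdec j₀ (hk 0)
      have : 0 ≤ c * ‖x (j₀ + 1) - x j₀‖ ^ 2 := by positivity
      simp only [zero_add, mul_one]
      linarith
    | succ j ih =>
      refine ⟨ih.2, hmove _ ih.2.1 ih.2.2, ?_⟩
      have h1 := hloc (j₀ + j) (hk j) ((hmove _ ih.2.1 ih.2.2).trans (hball _))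
      have h2 := hdec (j₀ + j) (hk j)
      have h3 := hdec (j₀ + j + 1) ((hk j).trans (Nat.le_succ _))
      change a (j₀ + j + 2) ≤ _
      have h4 : a (j₀ + j + 2) ≤ θ * a (j₀ + j) := by
        rw [hθ, div_mul_eq_mul_div, le_div_iff₀ (by positivity)]
        have h5 := mul_le_mul_of_nonneg_left h1 hc.le
        have h6 : C * (c * (‖x (j₀ + j + 2) - x (j₀ + j + 1)‖ ^ 2
            + ‖x (j₀ + j + 1) - x (j₀ + j)‖ ^ 2)) ≤ C * (a (j₀ + j) - a (j₀ + j + 2)) := by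
          simp only [add_assoc, Nat.reduceAdd] at *
          gcongr
          linarith
        linarith
      refine h4.trans ?_
      calc θ * a (j₀ + j) ≤ θ * (B * s ^ (2 * j)) := by gcongr; exact ih.1.2
        _ = _ := by rw [← hs4]; ring
  refine ⟨s ^ 2, by positivity, pow_lt_one₀ hs0.le hs1 two_ne_zero, j₀, (le_max_right _ _).trans hj₀,
    B / (s ^ 2) ^ j₀, by positivity, fun k hk' => ?_⟩
  obtain ⟨j, rfl⟩ := Nat.exists_eq_add_of_le hk'
  refine (key j).1.2.trans_eq ?_
  rw [pow_add, ← pow_mul s 2 j]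
  field_simp

namespace ZeroOneCOP
variable {n m : ℕ} {P : ZeroOneCOP n m} {S : NALMParams}

/-- The violation in coordinate `i` of the constraints that define the critical cone. -/
def coneViolation (us ys w : Euc m) (i : Fin m) : ℝ :=
  if us i = 0 then if 0 < ys i then |w i| else if ys i = 0 then max (w i) 0 else 0 else 0

theorem coneViolation_nonneg (us ys w : Euc m) (i : Fin m) : 0 ≤ coneViolation us ys w i := by
  unfold coneViolation; split_ifs <;> positivity

theorem coneViolation_smul (us ys w : Euc m) (i : Fin m) {t : ℝ} (ht : 0 ≤ t) :
    coneViolation us ys (t • w) i = t * coneViolation us ys w i := by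
  unfold coneViolation
  split_ifs <;> simp [abs_mul, abs_of_nonneg ht, mul_max_of_nonneg _ _ ht]

theorem continuous_coneViolation (us ys : Euc m) (i : Fin m) :
    Continuous fun w => coneViolation us ys w i := by
  unfold coneViolation
  split_ifs <;> fun_prop

theorem SOSC.exists_penalty {xs : Euc n} {us ys : Euc m} (h : P.SOSC xs us ys) :
    ∃ κ M : ℝ, 0 < κ ∧ 0 ≤ M ∧ ∀ d : Euc n, κ * ‖d‖ ^ 2
      ≤ inner ℝ d (hessian P.f xs d) + M * ∑ i, coneViolation us ys (P.mulAL d) i ^ 2 := by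
  obtain ⟨κ, M, hκ, hM, hmain⟩ := (isCompact_sphere (0 : Euc n) 1).exists_penalty
    (q := fun d => inner ℝ d (hessian P.f xs d))
    (p := fun d => ∑ i, coneViolation us ys (P.mulAL d) i ^ 2)
    (by fun_prop)
    (continuous_finsetSum _ fun i _ =>
      ((continuous_coneViolation us ys i).comp P.mulAL.continuous).pow 2)
    (fun d => by positivity) (by
      intro d hd hp
      rw [Finset.sum_eq_zero_iff_of_nonneg (fun i _ => by positivity)] at hp
      have hp' : ∀ i, coneViolation us ys (P.mulAL d) i = 0 := fun i => by
        simpa using hp i (Finset.mem_univ i)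
      refine h d ⟨fun i h1 h2 => ?_, fun i h1 h2 => ?_⟩ ?_
      · have := hp' i
        rwa [coneViolation, if_pos h1, if_pos h2, abs_eq_zero] at this
      · have := hp' i
        rw [coneViolation, if_pos h1, if_neg (by rw [h2]; exact lt_irrefl _), if_pos h2] at this
        exact max_eq_right_iff.1 this
      · rintro rfl
        simp at hd)
  refine ⟨κ, M, hκ, hM, fun d => ?_⟩
  rcases eq_or_ne d 0 with rfl | hd
  · have : 0 ≤ M * ∑ i, coneViolation us ys (P.mulAL (0 : Euc n)) i ^ 2 := by positivity
    simpa using this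
  · have hn : 0 < ‖d‖ := norm_pos_iff.2 hd
    have h1 := hmain (‖d‖⁻¹ • d) (by simp [norm_smul, hn.ne'])
    simp only [map_smul, inner_smul_left, inner_smul_right,
      coneViolation_smul _ _ _ _ (inv_nonneg.2 hn.le), mul_pow, ← Finset.mul_sum, conj_trivial] at h1
    have h2 := mul_le_mul_of_nonneg_right h1 (sq_nonneg ‖d‖)
    refine h2.trans_eq ?_
    field_simp

end ZeroOneCOP
end

noncomputable section

open Filter Topology

theorem eventually_zeroOneLoss_ge {m : ℕ} {F : Filter ℕ} {u : ℕ → Euc m} {us : Euc m}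
    (hu : Tendsto u F (𝓝 us)) : ∀ᶠ k in F, zeroOneLoss us ≤ zeroOneLoss (u k) := by
  have h : ∀ i, ∀ᶠ k in F, 0 < us i → 0 < u k i := fun i => by
    by_cases hi : 0 < us i
    · have : Tendsto (fun k => u k i) F (𝓝 (us i)) :=
        ((EuclideanSpace.proj i).continuous.tendsto us).comp hu
      exact (this.eventually_const_lt hi).mono fun k hk _ => hk
    · exact Eventually.of_forall fun k h => absurd h hi
  exact (eventually_all.2 h).mono fun k hk => zeroOneLoss_le_of_pos_imp hk

namespace ZeroOneCOP
variable {n m : ℕ} {P : ZeroOneCOP n m} {S : NALMParams}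

theorem eventually_zeroOneLoss_le {F : Filter ℕ} {u y : ℕ → Euc m} {us ys : Euc m} {ε : ℕ → ℝ}
    {α c : ℝ} (hα : 0 < α) (hc : 0 < c) (hu : Tendsto u F (𝓝 us)) (hy : Tendsto y F (𝓝 ys))
    (hε : Tendsto ε F (𝓝 0))
    (hprox : ∀ᶠ k in F, α ^ 2 / 2 * ‖y k‖ ^ 2 + α * c * zeroOneLoss (u k)
      ≤ α * c * zeroOneLoss us + (1 / 2) * ‖us - (u k + α • y k)‖ ^ 2 + ε k) :
    ∀ᶠ k in F, zeroOneLoss (u k) ≤ zeroOneLoss us := by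
  have h1 : Tendsto (fun k => (1 / 2) * ‖us - (u k + α • y k)‖ ^ 2 + ε k - α ^ 2 / 2 * ‖y k‖ ^ 2) F
      (𝓝 ((1 / 2) * ‖us - (us + α • ys)‖ ^ 2 + 0 - α ^ 2 / 2 * ‖ys‖ ^ 2)) :=
    (((((tendsto_const_nhds.sub (hu.add (hy.const_smul α))).norm).pow 2).const_mul _).add hε).sub
      ((hy.norm.pow 2).const_mul _)
  have h2 : (1 / 2) * ‖us - (us + α • ys)‖ ^ 2 + 0 - α ^ 2 / 2 * ‖ys‖ ^ 2 = 0 := by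
    rw [sub_add_cancel_left, norm_neg, norm_smul, mul_pow, Real.norm_eq_abs, sq_abs]; ring
  rw [h2] at h1
  have hac : 0 < α * c := mul_pos hα hc
  filter_upwards [h1.eventually_lt_const hac, hprox] with k hk hprox
  refine zeroOneLoss_le_of_lt_add_one (lt_of_mul_lt_mul_left ?_ hac.le)
  linarith

theorem eventually_compl_bounds {F : Filter ℕ} {u y : ℕ → Euc m} {D : ℕ → ℝ} {us ys : Euc m}
    {α c τ : ℝ} (hα : 0 < α) (hc : 0 ≤ c) (hτ : 0 < τ) (hu : Tendsto u F (𝓝 us))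
    (hy : Tendsto y F (𝓝 ys)) (hD : Tendsto D F (𝓝 0))
    (hcompl : ∀ k i, |u k i| ≤ c * D k ^ 2 ∨ (α * |y k i| ≤ c * D k ^ 2 ∧
      (0 ≤ u k i + α * y k i → τ ≤ u k i + α * y k i))) :
    ∀ᶠ k in F, ∀ i,
      |y k i - ys i| * |u k i - us i| ≤ c * (1 + 1 / α + ‖ys‖) * D k ^ 2 ∧
      |ys i| * |u k i - us i| ≤ c * (1 + 1 / α + ‖ys‖) * D k ^ 2 ∧
      ∀ r : Euc m, coneViolation us ys (u k - us + r) i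
        ≤ c * (1 + 1 / α + ‖ys‖) * D k ^ 2 + |r i| := by
  refine eventually_all.2 fun i => ?_
  have hui : Tendsto (fun k => u k i) F (𝓝 (us i)) :=
    ((EuclideanSpace.proj i).continuous.tendsto us).comp hu
  have hyi : Tendsto (fun k => y k i) F (𝓝 (ys i)) :=
    ((EuclideanSpace.proj i).continuous.tendsto ys).comp hy
  have hD2 : Tendsto (fun k => c * D k ^ 2) F (𝓝 0) := by simpa using (hD.pow 2).const_mul c
  have e1 : ∀ᶠ k in F, us i ≠ 0 → c * D k ^ 2 < |u k i| := by
    by_cases h : us i = 0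
    · exact Eventually.of_forall fun k hk => absurd h hk
    · exact (hD2.eventually_lt hui.abs (abs_pos.2 h)).mono fun k hk _ => hk
  have e2 : ∀ᶠ k in F, ys i ≠ 0 → c * D k ^ 2 < α * |y k i| := by
    by_cases h : ys i = 0
    · exact Eventually.of_forall fun k hk => absurd h hk
    · exact (hD2.eventually_lt (hyi.abs.const_mul α) (mul_pos hα (abs_pos.2 h))).mono
        fun k hk _ => hk
  have e3 : ∀ᶠ k in F, us i = 0 → ys i = 0 → u k i + α * y k i < τ := by
    by_cases h : us i = 0 ∧ ys i = 0
    · have : Tendsto (fun k => u k i + α * y k i) F (𝓝 0) := by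
        simpa [h.1, h.2] using hui.add (hyi.const_mul α)
      exact (this.eventually_lt_const hτ).mono fun k hk _ _ => hk
    · exact Eventually.of_forall fun k h1 h2 => absurd ⟨h1, h2⟩ h
  have e4 : ∀ᶠ k in F, |u k i - us i| < 1 := by
    have : Tendsto (fun k => |u k i - us i|) F (𝓝 0) := by simpa using (hui.sub_const (us i)).abs
    exact this.eventually_lt_const one_pos
  have e5 : ∀ᶠ k in F, |y k i - ys i| < 1 := by
    have : Tendsto (fun k => |y k i - ys i|) F (𝓝 0) := by simpa using (hyi.sub_const (ys i)).abs
    exact this.eventually_lt_const one_pos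
  filter_upwards [e1, e2, e3, e4, e5] with k e1 e2 e3 e4 e5
  have hE : 0 ≤ c * D k ^ 2 := by positivity
  have hC : c * (1 + 1 / α + ‖ys‖) * D k ^ 2
      = c * D k ^ 2 + c * D k ^ 2 / α + ‖ys‖ * (c * D k ^ 2) := by ring
  have hE1 : 0 ≤ c * D k ^ 2 / α := by positivity
  have hE2 : 0 ≤ ‖ys‖ * (c * D k ^ 2) := by positivity
  rw [hC]
  rcases hcompl k i with h | ⟨h, h'⟩
  · have hus : us i = 0 := by
      by_contra hne
      exact absurd h (not_le.2 (e1 hne))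
    rw [hus, sub_zero] at e4 ⊢
    refine ⟨?_, ?_, fun r => ?_⟩
    · have := mul_le_mul e5.le h (abs_nonneg _) zero_le_one
      linarith
    · have := mul_le_mul (abs_apply_le_norm ys i) h (abs_nonneg _) (norm_nonneg _)
      linarith
    · have h1 : coneViolation us ys (u k - us + r) i ≤ |u k i + r i| := by
        unfold coneViolation
        simp only [hus, PiLp.add_apply, PiLp.sub_apply, sub_zero]
        split_ifs <;> first | exact le_rfl | exact abs_nonneg _ |
          exact max_le (le_abs_self _) (abs_nonneg _)
      linarith [abs_add_le (u k i) (r i)]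
  · have hys : ys i = 0 := by
      by_contra hne
      exact absurd h (not_le.2 (e2 hne))
    have h2 : |y k i| ≤ c * D k ^ 2 / α := by rw [le_div_iff₀ hα]; linarith
    rw [hys, sub_zero] at e5 ⊢
    refine ⟨?_, ?_, fun r => ?_⟩
    · have := mul_le_mul h2 e4.le (abs_nonneg _) hE1
      linarith
    · simp only [abs_zero, zero_mul]; linarith
    · unfold coneViolation
      split_ifs with h3 h4
      · exact absurd h4 (by rw [hys]; exact lt_irrefl _)
      · have h5 : u k i + α * y k i < 0 := by
          by_contra hcon
          exact absurd (h' (not_lt.1 hcon)) (not_le.2 (e3 h3 hys))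
        have h6 : -(α * y k i) ≤ α * |y k i| := by
          rw [← mul_neg]; exact mul_le_mul_of_nonneg_left (neg_le_abs _) hα.le
        simp only [PiLp.add_apply, PiLp.sub_apply, h3, sub_zero]
        refine max_le ?_ ?_
        · linarith [le_abs_self (r i)]
        · linarith [abs_nonneg (r i)]
      · linarith [abs_nonneg (r i)]

theorem mulAL_sub_of_resid_eq_zero {xs : Euc n} {us : Euc m} (hfeas : P.resid xs us = 0)
    (x : Euc n) (u : Euc m) : P.mulAL (x - xs) = u - us + P.resid x u := by
  have h1 : P.mulAL xs + P.b - us = 0 := hfeas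
  have h2 : P.b = us - P.mulAL xs := by rw [eq_sub_iff_add_eq, add_comm, ← sub_eq_zero, h1]
  rw [resid_eq, h2, map_sub]
  abel

/-- The error bound that the penalized second-order condition gives near a KKT point. -/
theorem norm_sq_le_of_penalty {xs x : Euc n} {us u ys y : Euc m} {κ M C K Ky Ks D : ℝ}
    (hκ : 0 < κ) (hM : 0 ≤ M) (hC : 0 ≤ C) (hD0 : 0 ≤ D) (hD1 : D ≤ 1)
    (hpen : ∀ d : Euc n, κ * ‖d‖ ^ 2
      ≤ inner ℝ d (hessian P.f xs d) + M * ∑ i, coneViolation us ys (P.mulAL d) i ^ 2)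
    (htaylor : ‖gradient P.f x - gradient P.f xs - hessian P.f xs (x - xs)‖ ≤ κ / 4 * ‖x - xs‖)
    (hkkt : gradient P.f xs + P.mulATL ys = 0) (hfeas : P.resid xs us = 0)
    (hs : ‖gradient P.f x + P.mulATL y‖ ≤ Ks * D) (hr : ‖P.resid x u‖ ≤ K * D)
    (hy : ‖y - ys‖ ≤ Ky * (‖x - xs‖ + D))
    (hcompl : ∀ i, |y i - ys i| * |u i - us i| ≤ C * D ^ 2)
    (hviol : ∀ i, coneViolation us ys (u - us + P.resid x u) i ≤ C * D ^ 2 + |P.resid x u i|) :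
    ‖x - xs‖ ^ 2 ≤ (2 / κ * (m * C + K * Ky + M * (m * (C + K) ^ 2)
      + (Ks + K * Ky) ^ 2 / κ)) * D ^ 2 := by
  set e := x - xs with he
  have hAe : P.mulAL e = u - us + P.resid x u := mulAL_sub_of_resid_eq_zero hfeas x u
  have h1 := hpen e
  have h2 : inner ℝ e (hessian P.f xs e)
      ≤ inner ℝ e (gradient P.f x - gradient P.f xs) + κ / 4 * ‖e‖ ^ 2 := by
    have h3 : |inner ℝ e (gradient P.f x - gradient P.f xs - hessian P.f xs e)|
        ≤ ‖e‖ * (κ / 4 * ‖e‖) :=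
      (abs_real_inner_le_norm _ _).trans (mul_le_mul_of_nonneg_left htaylor (norm_nonneg _))
    rw [inner_sub_right] at h3
    have := neg_le_of_abs_le h3
    linarith
  have h3 : gradient P.f x - gradient P.f xs
      = (gradient P.f x + P.mulATL y) - P.mulATL (y - ys) := by
    rw [map_sub, ← eq_neg_iff_add_eq_zero] at *
    rw [hkkt]
    abel
  have h4 : inner ℝ e (gradient P.f x - gradient P.f xs)
      = inner ℝ e (gradient P.f x + P.mulATL y) - inner ℝ (y - ys) (u - us)
        - inner ℝ (y - ys) (P.resid x u) := by
    rw [h3, inner_sub_right, real_inner_comm (P.mulATL (y - ys)), ← inner_mulAL, hAe,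
      inner_add_right (y - ys)]
    ring
  have h5 : inner ℝ e (gradient P.f x + P.mulATL y) ≤ ‖e‖ * (Ks * D) :=
    (real_inner_le_norm _ _).trans (mul_le_mul_of_nonneg_left hs (norm_nonneg _))
  have h6 : -inner ℝ (y - ys) (u - us) ≤ m * (C * D ^ 2) := by
    rw [inner_eq_sum_mul, ← Finset.sum_neg_distrib]
    refine (Finset.sum_le_card_nsmul _ _ (C * D ^ 2) fun i _ => ?_).trans_eq (by simp)
    refine (neg_le_abs _).trans ?_
    rw [abs_mul]
    exact hcompl i
  have h7 : -inner ℝ (y - ys) (P.resid x u) ≤ Ky * (‖e‖ + D) * (K * D) := by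
    refine (neg_le_abs _).trans ((abs_real_inner_le_norm _ _).trans ?_)
    exact mul_le_mul hy hr (norm_nonneg _) ((norm_nonneg _).trans hy)
  have h8 : ∑ i, coneViolation us ys (P.mulAL e) i ^ 2 ≤ m * ((C + K) * D) ^ 2 := by
    refine (Finset.sum_le_card_nsmul _ _ (((C + K) * D) ^ 2) fun i _ => ?_).trans_eq (by simp)
    refine pow_le_pow_left₀ (coneViolation_nonneg _ _ _ _) ?_ 2
    rw [hAe]
    refine (hviol i).trans ?_
    have h9 := (abs_apply_le_norm (P.resid x u) i).trans hr
    have h10 : C * D ^ 2 ≤ C * D := by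
      refine mul_le_mul_of_nonneg_left ?_ hC
      nlinarith
    linarith
  have h9 := mul_le_mul_of_nonneg_left h8 hM
  have h10 : (Ks + K * Ky) * D * ‖e‖ ≤ κ / 4 * ‖e‖ ^ 2 + (Ks + K * Ky) ^ 2 / κ * D ^ 2 := by
    have h11 : 0 ≤ (κ / 2 * ‖e‖ - (Ks + K * Ky) * D) ^ 2 / κ := by positivity
    have h12 : (κ / 2 * ‖e‖ - (Ks + K * Ky) * D) ^ 2 / κ
        = κ / 4 * ‖e‖ ^ 2 - (Ks + K * Ky) * D * ‖e‖ + (Ks + K * Ky) ^ 2 / κ * D ^ 2 := by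
      field_simp
      ring
    linarith
  have h11 : κ / 2 * ‖e‖ ^ 2 ≤ (m * C + K * Ky + M * (m * (C + K) ^ 2)
      + (Ks + K * Ky) ^ 2 / κ) * D ^ 2 := by
    linarith
  have h12 := mul_le_mul_of_nonneg_left h11 (show 0 ≤ 2 / κ by positivity)
  have h13 : 2 / κ * (κ / 2 * ‖e‖ ^ 2) = ‖e‖ ^ 2 := by field_simp
  linarith

/-- Near a KKT point the Lyapunov gap is of second order in the distance and the residuals. -/
theorem lyap_sub_le {xs x v : Euc n} {us u ys y : Euc m} {ℓ ρ β C K Ky D : ℝ}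
    (hf : Differentiable ℝ P.f)
    (hgrad : ∀ x x' : Euc n, ‖gradient P.f x - gradient P.f x'‖ ≤ ℓ * ‖x - x'‖)
    (hlam : 0 ≤ P.lam) (hρ : 0 ≤ ρ) (hβ : 0 ≤ β) (hv : ‖x - v‖ ≤ D)
    (hkkt : gradient P.f xs + P.mulATL ys = 0) (hfeas : P.resid xs us = 0)
    (hr : ‖P.resid x u‖ ≤ K * D) (hy : ‖y - ys‖ ≤ Ky * (‖x - xs‖ + D))
    (hcompl : ∀ i, |ys i| * |u i - us i| ≤ C * D ^ 2)
    (hloss : zeroOneLoss u ≤ zeroOneLoss us) :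
    P.lyap ρ β x u y v - P.lyap ρ β xs us ys xs
      ≤ m * (C * D ^ 2) + Ky * (‖x - xs‖ + D) * (K * D) + ℓ / 2 * ‖x - xs‖ ^ 2
        + ρ / 2 * (K * D) ^ 2 + β / 2 * D ^ 2 := by
  set e := x - xs with he
  have hAe : P.mulAL e = u - us + P.resid x u := mulAL_sub_of_resid_eq_zero hfeas x u
  have h1 := le_add_inner_add_sq_of_lipschitz_gradient (fun x => (hf x).hasGradientAt) hgrad xs e
  have h2 : gradient P.f xs = -P.mulATL ys := eq_neg_of_add_eq_zero_left hkkt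
  rw [h2, inner_neg_left, ← inner_mulAL, hAe, inner_add_right, he, add_sub_cancel] at h1
  have h6 : -inner ℝ ys (u - us) ≤ m * (C * D ^ 2) := by
    rw [inner_eq_sum_mul, ← Finset.sum_neg_distrib]
    refine (Finset.sum_le_card_nsmul _ _ (C * D ^ 2) fun i _ => ?_).trans_eq (by simp)
    refine (neg_le_abs _).trans ?_
    rw [abs_mul]
    exact hcompl i
  have h7 : inner ℝ (y - ys) (P.resid x u) ≤ Ky * (‖e‖ + D) * (K * D) :=
    (real_inner_le_norm _ _).trans (mul_le_mul hy hr (norm_nonneg _) ((norm_nonneg _).trans hy))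
  rw [inner_sub_left] at h7
  have h8 : ρ / 2 * ‖P.resid x u‖ ^ 2 ≤ ρ / 2 * (K * D) ^ 2 := by gcongr
  have h9 : β / 2 * ‖x - v‖ ^ 2 ≤ β / 2 * D ^ 2 := by gcongr
  have h10 := mul_le_mul_of_nonneg_left hloss hlam
  simp only [lyap, augLag, hfeas, inner_zero_right, norm_zero, sub_self]
  rw [← he] at h1
  linarith

end ZeroOneCOP
end

noncomputable section

open Filter Topology

theorem continuous_gradient_of_lipschitz {n : ℕ} {f : Euc n → ℝ} {ℓ : ℝ}
    (hgrad : ∀ x x' : Euc n, ‖gradient f x - gradient f x'‖ ≤ ℓ * ‖x - x'‖) :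
    Continuous (gradient f) := by
  refine (LipschitzWith.of_dist_le_mul (K := ℓ.toNNReal) fun x x' => ?_).continuous
  rw [dist_eq_norm, dist_eq_norm]
  exact (hgrad x x').trans (mul_le_mul_of_nonneg_right (Real.le_coe_toNNReal ℓ) (norm_nonneg _))

theorem differentiable_gradient {n : ℕ} {f : Euc n → ℝ} (hf : ContDiff ℝ 2 f) :
    Differentiable ℝ (gradient f) := by
  have h1 : Differentiable ℝ (fderiv ℝ f) :=
    (hf.fderiv_right (m := 1) (by norm_num)).differentiable one_ne_zero
  exact (InnerProductSpace.toDual ℝ (Euc n)).symm.toContinuousLinearEquiv.differentiable.comp h1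

namespace ZeroOneCOP
variable {n m : ℕ} {P : ZeroOneCOP n m} {S : NALMParams}

theorem tendsto_resid {ι : Type*} {F : Filter ι} {x : ι → Euc n} {u : ι → Euc m} {xs : Euc n}
    {us : Euc m} (hx : Tendsto x F (𝓝 xs)) (hu : Tendsto u F (𝓝 us)) :
    Tendsto (fun k => P.resid (x k) (u k)) F (𝓝 (P.resid xs us)) :=
  (((P.mulAL.continuous.tendsto xs).comp hx).add_const P.b).sub hu

/-- The smooth part of the augmented Lagrangian is continuous. -/
theorem tendsto_smoothLag (hf : Continuous P.f) {ι : Type*} {F : Filter ι} {x : ι → Euc n}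
    {u y : ι → Euc m} {xs : Euc n} {us ys : Euc m} (ρ : ℝ) (hx : Tendsto x F (𝓝 xs))
    (hu : Tendsto u F (𝓝 us)) (hy : Tendsto y F (𝓝 ys)) :
    Tendsto (fun k => P.f (x k) + inner ℝ (y k) (P.resid (x k) (u k))
        + ρ / 2 * ‖P.resid (x k) (u k)‖ ^ 2) F
      (𝓝 (P.f xs + inner ℝ ys (P.resid xs us) + ρ / 2 * ‖P.resid xs us‖ ^ 2)) := by
  have hr : Tendsto (fun k => P.resid (x k) (u k)) F (𝓝 (P.resid xs us)) :=
    tendsto_resid hx hu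
  exact (((hf.tendsto xs).comp hx).add (hy.inner hr)).add ((hr.norm.pow 2).const_mul _)

/-- The Lyapunov values converge, and the steps tend to zero, if the iterates have a cluster point. -/
theorem exists_tendsto_lyapSeq (hf : Continuous P.f) {x : ℕ → Euc n} {u y : ℕ → Euc m} {β c : ℝ}
    (hlam : 0 ≤ P.lam) (hβ : 0 ≤ β) (hc : 0 < c)
    (hdec : ∀ k, P.lyapSeq S β x u y (k + 2) + c * ‖x (k + 2) - x (k + 1)‖ ^ 2
      ≤ P.lyapSeq S β x u y (k + 1))
    {xs : Euc n} {us ys : Euc m} {F : Filter ℕ} [F.NeBot] (hF : F ≤ atTop)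
    (hx : Tendsto x F (𝓝 xs)) (hu : Tendsto u F (𝓝 us)) (hy : Tendsto y F (𝓝 ys)) :
    ∃ L, Tendsto (P.lyapSeq S β x u y) atTop (𝓝 L) ∧ (∀ k, L ≤ P.lyapSeq S β x u y (k + 1)) ∧
      Tendsto (fun k => ‖x (k + 1) - x k‖) atTop (𝓝 0) := by
  have hanti : Antitone fun k => P.lyapSeq S β x u y (k + 1) :=
    antitone_nat_of_succ_le fun k => by
      have : 0 ≤ c * ‖x (k + 2) - x (k + 1)‖ ^ 2 := by positivity
      have := hdec k
      simp only [add_assoc, Nat.reduceAdd]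
      linarith
  have hlim := tendsto_smoothLag hf S.rho hx hu hy
  have hbound := hlim.eventually_const_lt (sub_one_lt _)
  set c₀ := P.f xs + inner ℝ ys (P.resid xs us) + S.rho / 2 * ‖P.resid xs us‖ ^ 2 - 1
  have hlow : ∀ᶠ k in F, c₀ ≤ P.lyapSeq S β x u y k := hbound.mono fun k hk => by
    have h1 : 0 ≤ P.lam * zeroOneLoss (u k) := mul_nonneg hlam (zeroOneLoss_nonneg _)
    have h2 : 0 ≤ β / 2 * ‖x k - x (k - 1)‖ ^ 2 := by positivity
    simp only [lyapSeq, lyap, augLag]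
    linarith
  have hall : ∀ k, c₀ ≤ P.lyapSeq S β x u y (k + 1) := by
    intro k
    obtain ⟨j, hj, hjk⟩ := (hlow.and (hF (eventually_ge_atTop (k + 1)))).exists
    obtain ⟨i, rfl⟩ := Nat.exists_eq_add_of_le' hjk
    refine hj.trans ?_
    rw [← add_assoc]
    exact hanti (Nat.le_add_left k i)
  have hconv := tendsto_atTop_ciInf hanti ⟨c₀, by rintro _ ⟨k, rfl⟩; exact hall k⟩
  refine ⟨_, (tendsto_add_atTop_iff_nat 1).1 hconv, fun k => hanti.le_of_tendsto hconv k, ?_⟩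
  rw [← tendsto_add_atTop_iff_nat 1]
  have h1 := (hconv.sub ((tendsto_add_atTop_iff_nat 1).2 hconv)).div_const c
  rw [sub_self, zero_div] at h1
  have h2 : Tendsto (fun k => ‖x (k + 2) - x (k + 1)‖ ^ 2) atTop (𝓝 0) :=
    squeeze_zero (fun k => by positivity) (fun k => by
      rw [le_div_iff₀ hc]
      have := hdec k
      simp only [add_assoc, Nat.reduceAdd]
      linarith) h1
  simpa [Real.sqrt_sq (norm_nonneg _)] using h2.sqrt

theorem IsApproxKKTSequence.resid_succ {x : ℕ → Euc n} {u y : ℕ → Euc m}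
    (h : P.IsApproxKKTSequence S x u y) (hρ : 0 < S.rho) (k : ℕ) :
    P.resid (x (k + 1)) (u (k + 1)) = S.rho⁻¹ • (y (k + 1) - y k) := by
  rw [h.dual k, add_sub_cancel_left, inv_smul_smul₀ hρ.ne']

theorem IsApproxKKTSequence.stat' {x : ℕ → Euc n} {u y : ℕ → Euc m}
    (h : P.IsApproxKKTSequence S x u y) (hμ : 0 < S.mu) (k : ℕ) :
    ‖gradient P.f (x (k + 1)) + P.mulATL (y (k + 1))‖ ≤ (S.mu + S.c₁) * ‖x (k + 1) - x k‖ := by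
  have h1 := norm_sub_le (gradient P.f (x (k + 1)) + P.mulATL (y (k + 1))
    + S.mu • (x (k + 1) - x k)) (S.mu • (x (k + 1) - x k))
  rw [add_sub_cancel_right, norm_smul, Real.norm_of_nonneg hμ.le] at h1
  linarith [h.stat k]

theorem IsApproxKKTSequence.dual_error_le {x : ℕ → Euc n} {u y : ℕ → Euc m}
    (h : P.IsApproxKKTSequence S x u y) {ℓ γ : ℝ} {xs : Euc n} {ys : Euc m}
    (hgrad : ∀ x x' : Euc n, ‖gradient P.f x - gradient P.f x'‖ ≤ ℓ * ‖x - x'‖) (hγ : 0 < γ)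
    (hγA : ∀ y, γ * ‖y‖ ≤ ‖P.mulATL y‖) (hμ : 0 < S.mu) (hc₁ : 0 < S.c₁)
    (hkkt : gradient P.f xs + P.mulATL ys = 0) (k : ℕ) :
    ‖y (k + 1) - ys‖ ≤ (|ℓ| + S.mu + S.c₁) / γ * (‖x (k + 1) - xs‖ + ‖x (k + 1) - x k‖) := by
  have h1 := hγA (y (k + 1) - ys)
  have h2 : P.mulATL (y (k + 1) - ys) = (gradient P.f (x (k + 1)) + P.mulATL (y (k + 1)))
      - (gradient P.f (x (k + 1)) - gradient P.f xs) := by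
    rw [map_sub, eq_neg_of_add_eq_zero_left hkkt]; abel
  rw [h2] at h1
  have h3 := h1.trans (norm_sub_le _ _)
  have h4 := h.stat' hμ k
  have h5 := hgrad (x (k + 1)) xs
  have h6 := mul_le_mul_of_nonneg_right (le_abs_self ℓ) (norm_nonneg (x (k + 1) - xs))
  have h7 : 0 ≤ |ℓ| * ‖x (k + 1) - x k‖ := by positivity
  have h8 : 0 ≤ (S.mu + S.c₁) * ‖x (k + 1) - xs‖ := by positivity
  rw [div_mul_eq_mul_div, le_div_iff₀ hγ]
  linarith

end ZeroOneCOP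
end

noncomputable section

open Filter Topology
namespace ZeroOneCOP
variable {n m : ℕ} {P : ZeroOneCOP n m} {S : NALMParams}

theorem IsApproxKKTSequence.resid_le {x : ℕ → Euc n} {u y : ℕ → Euc m}
    (h : P.IsApproxKKTSequence S x u y) {c₃ c₄ : ℝ} (hρ : 0 < S.rho)
    (hdiff : ∀ k, ‖y (k + 2) - y (k + 1)‖
      ≤ c₃ * ‖x (k + 2) - x (k + 1)‖ + c₄ * ‖x (k + 1) - x k‖) (k : ℕ) :
    ‖P.resid (x (k + 2)) (u (k + 2))‖ ≤ S.rho⁻¹ * (|c₃| + |c₄|) *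
      (‖x (k + 2) - x (k + 1)‖ + ‖x (k + 1) - x k‖) := by
  rw [h.resid_succ hρ (k + 1), norm_smul, norm_inv, Real.norm_of_nonneg hρ.le, mul_assoc]
  refine mul_le_mul_of_nonneg_left ((hdiff k).trans ?_) (inv_nonneg.2 hρ.le)
  have h1 := mul_le_mul_of_nonneg_right (le_abs_self c₃) (norm_nonneg (x (k + 2) - x (k + 1)))
  have h2 := mul_le_mul_of_nonneg_right (le_abs_self c₄) (norm_nonneg (x (k + 1) - x k))
  have h3 : 0 ≤ |c₃| * ‖x (k + 1) - x k‖ := by positivity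
  have h4 : 0 ≤ |c₄| * ‖x (k + 2) - x (k + 1)‖ := by positivity
  linarith

/-- Near a KKT point that satisfies the second-order condition, the Lyapunov gap is bounded by the
last two squared steps. -/
theorem IsApproxKKTSequence.exists_local_bound {x : ℕ → Euc n} {u y : ℕ → Euc m}
    (h : P.IsApproxKKTSequence S x u y) (hf : ContDiff ℝ 2 P.f) {ℓ β K Ky : ℝ}
    (hgrad : ∀ x x' : Euc n, ‖gradient P.f x - gradient P.f x'‖ ≤ ℓ * ‖x - x'‖)
    (hlam : 0 < P.lam) (hμ : 0 < S.mu) (hρ : 0 < S.rho) (hα : 0 < S.alpha) (hc₁ : 0 < S.c₁)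
    (hc₂ : 0 < S.c₂) (heps : Tendsto S.eps atTop (𝓝 0)) (hβ : 0 ≤ β) (hK : 0 ≤ K) (hKy : 0 ≤ Ky)
    {xs : Euc n} {us ys : Euc m} (hsosc : P.SOSC xs us ys)
    (hkkt : gradient P.f xs + P.mulATL ys = 0) (hfeas : P.resid xs us = 0)
    (hstep : Tendsto (fun k => ‖x (k + 1) - x k‖) atTop (𝓝 0))
    (hr : ∀ k, ‖P.resid (x (k + 2)) (u (k + 2))‖
      ≤ K * (‖x (k + 2) - x (k + 1)‖ + ‖x (k + 1) - x k‖))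
    (hy : ∀ k, ‖y (k + 1) - ys‖ ≤ Ky * (‖x (k + 1) - xs‖ + ‖x (k + 1) - x k‖)) :
    ∃ C δ : ℝ, 0 < C ∧ 0 < δ ∧ ∃ k₀ : ℕ, ∀ k, k₀ ≤ k → ‖x (k + 2) - xs‖ ≤ δ →
      P.lyapSeq S β x u y (k + 2) - P.lyap S.rho β xs us ys xs
        ≤ C * (‖x (k + 2) - x (k + 1)‖ ^ 2 + ‖x (k + 1) - x k‖ ^ 2) := by
  have hfd : Differentiable ℝ P.f := hf.differentiable two_ne_zero
  obtain ⟨κ, M, hκ, hM, hpen⟩ := hsosc.exists_penalty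
  set D : ℕ → ℝ := fun k => ‖x (k + 2) - x (k + 1)‖ + ‖x (k + 1) - x k‖ with hDdef
  have hD0 : ∀ k, 0 ≤ D k := fun k => by positivity
  have hle : ∀ k, ‖x (k + 2) - x (k + 1)‖ ≤ D k := fun k =>
    le_add_of_nonneg_right (norm_nonneg _)
  set G : Filter ℕ := comap (fun k => x (k + 2)) (𝓝 xs) ⊓ atTop with hG
  have hGtop : G ≤ atTop := inf_le_right
  have hxG : Tendsto (fun k => x (k + 2)) G (𝓝 xs) := tendsto_comap.mono_left inf_le_left
  have hDG : Tendsto D G (𝓝 0) := by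
    simpa using (((tendsto_add_atTop_iff_nat 1).2 hstep).add hstep).mono_left hGtop
  have hy' : ∀ k, ‖y (k + 2) - ys‖ ≤ Ky * (‖x (k + 2) - xs‖ + D k) := fun k =>
    (hy (k + 1)).trans (mul_le_mul_of_nonneg_left (add_le_add_right (hle k) _) hKy)
  have hxnorm : Tendsto (fun k => ‖x (k + 2) - xs‖) G (𝓝 0) := by
    simpa using (hxG.sub_const xs).norm
  have hyG : Tendsto (fun k => y (k + 2)) G (𝓝 ys) := by
    rw [tendsto_iff_norm_sub_tendsto_zero]
    exact squeeze_zero (fun _ => norm_nonneg _) hy' (by simpa using (hxnorm.add hDG).const_mul Ky)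
  have hrG : Tendsto (fun k => P.resid (x (k + 2)) (u (k + 2))) G (𝓝 0) := by
    rw [tendsto_zero_iff_norm_tendsto_zero]
    exact squeeze_zero (fun _ => norm_nonneg _) hr (by simpa using hDG.const_mul K)
  have huG : Tendsto (fun k => u (k + 2)) G (𝓝 us) := by
    have h1 : ∀ k, us + P.mulAL (x (k + 2) - xs) - P.resid (x (k + 2)) (u (k + 2)) = u (k + 2) := by
      intro k
      rw [mulAL_sub_of_resid_eq_zero hfeas (x (k + 2)) (u (k + 2))]
      abel
    have h2 : Tendsto (fun k => P.mulAL (x (k + 2) - xs)) G (𝓝 0) := by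
      simpa [Function.comp_def] using
        (P.mulAL.continuous.tendsto (xs - xs)).comp (hxG.sub_const xs)
    have h3 := (h2.const_add us).sub hrG
    simpa only [h1, add_zero, sub_zero] using h3
  have hloss : ∀ᶠ k in G, zeroOneLoss (u (k + 2)) ≤ zeroOneLoss us :=
    eventually_zeroOneLoss_le hα hlam huG hyG
      (((tendsto_add_atTop_iff_nat 1).2 heps).mono_left hGtop)
      (Eventually.of_forall fun k => h.prox (k + 1) us)
  have hcompl := eventually_compl_bounds hα hc₂.le
    (Real.sqrt_pos.2 (show 0 < 2 * S.alpha * P.lam by positivity)) huG hyG hDG (fun k i => by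
      have h1 : S.c₂ * ‖x (k + 2) - x (k + 1)‖ ^ 2 ≤ S.c₂ * D k ^ 2 := by
        have := hle k
        gcongr
      rcases h.compl (k + 1) i with h2 | ⟨h2, h3⟩
      · exact Or.inl (h2.trans h1)
      · exact Or.inr ⟨h2.trans h1, h3⟩)
  set Cc : ℝ := S.c₂ * (1 + 1 / S.alpha + ‖ys‖) with hCc
  have hCc0 : 0 ≤ Cc := by positivity
  have htaylor : ∀ᶠ k in G, ‖gradient P.f (x (k + 2)) - gradient P.f xs
      - hessian P.f xs (x (k + 2) - xs)‖ ≤ κ / 4 * ‖x (k + 2) - xs‖ :=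
    hxG.eventually (((differentiable_gradient hf) xs).hasFDerivAt.isLittleO.def
      (show 0 < κ / 4 by positivity))
  set E : ℝ := 2 / κ * (m * Cc + K * Ky + M * (m * (Cc + K) ^ 2)
      + (S.mu + S.c₁ + K * Ky) ^ 2 / κ) with hE
  set C : ℝ := m * Cc + Ky * K * ((E + 1) / 2 + 1) + |ℓ| / 2 * E + S.rho / 2 * K ^ 2 + β / 2 with hC
  have hE0 : 0 ≤ E := by positivity
  have hC0 : 0 ≤ C := by positivity
  have hmain : ∀ᶠ k in G, P.lyapSeq S β x u y (k + 2) - P.lyap S.rho β xs us ys xs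
        ≤ (2 * C + 1) * (‖x (k + 2) - x (k + 1)‖ ^ 2 + ‖x (k + 1) - x k‖ ^ 2) := by
    filter_upwards [hloss, hcompl, htaylor, hDG.eventually_le_const zero_lt_one]
      with k h1 h2 h3 h4
    have hs : ‖gradient P.f (x (k + 2)) + P.mulATL (y (k + 2))‖ ≤ (S.mu + S.c₁) * D k :=
      (h.stat' hμ (k + 1)).trans (mul_le_mul_of_nonneg_left (hle k) (by positivity))
    have h5 := norm_sq_le_of_penalty hκ hM hCc0 (hD0 k) h4 hpen h3 hkkt hfeas hs (hr k) (hy' k)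
      (fun i => (h2 i).1) (fun i => (h2 i).2.2 _)
    have h6 := lyap_sub_le (ρ := S.rho) (C := Cc) hfd hgrad hlam.le hρ.le hβ (hle k) hkkt hfeas (hr k) (hy' k)
      (fun i => (h2 i).2.1) h1
    rw [← hE] at h5
    have h7 : ‖x (k + 2) - xs‖ * D k ≤ (E + 1) / 2 * D k ^ 2 := by
      linarith [sq_nonneg (‖x (k + 2) - xs‖ - D k)]
    have h8 : Ky * (‖x (k + 2) - xs‖ + D k) * (K * D k)
        ≤ Ky * K * ((E + 1) / 2 + 1) * D k ^ 2 := by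
      have := mul_le_mul_of_nonneg_left h7 (mul_nonneg hKy hK)
      linarith
    have h9 : ℓ / 2 * ‖x (k + 2) - xs‖ ^ 2 ≤ |ℓ| / 2 * (E * D k ^ 2) := by
      have := le_abs_self ℓ
      gcongr
    have h10 : P.lyapSeq S β x u y (k + 2) - P.lyap S.rho β xs us ys xs ≤ C * D k ^ 2 := by
      have hCD : C * D k ^ 2 = m * (Cc * D k ^ 2) + Ky * K * ((E + 1) / 2 + 1) * D k ^ 2
          + |ℓ| / 2 * (E * D k ^ 2) + S.rho / 2 * (K * D k) ^ 2 + β / 2 * D k ^ 2 := by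
        rw [hC]; ring
      refine h6.trans ?_
      linarith
    have h11 : D k ^ 2 ≤ 2 * (‖x (k + 2) - x (k + 1)‖ ^ 2 + ‖x (k + 1) - x k‖ ^ 2) := add_sq_le
    have h12 := mul_le_mul_of_nonneg_left h11 hC0
    have h13 := sq_nonneg ‖x (k + 2) - x (k + 1)‖
    have h14 := sq_nonneg ‖x (k + 1) - x k‖
    linarith
  obtain ⟨⟨δ, k₀⟩, ⟨hδ, -⟩, hk⟩ := (((Metric.nhds_basis_closedBall (x := xs)).comap
    fun k => x (k + 2)).inf atTop_basis).eventually_iff.1 hmain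
  refine ⟨2 * C + 1, δ, by positivity, hδ, k₀, fun k hk₀ hx => hk ⟨?_, hk₀⟩⟩
  simpa [dist_eq_norm] using hx

/-- Steps of order `s ^ k` give the same rate of convergence to a cluster point. -/
theorem _root_.exists_norm_sub_le_of_step_le {E : Type*} [NormedAddCommGroup E] [CompleteSpace E]
    {x : ℕ → E} {xs : E} {B s : ℝ} {N : ℕ} (hs1 : s < 1)
    (hstep : ∀ k, N ≤ k → ‖x (k + 1) - x k‖ ≤ B * s ^ k)
    (hcl : MapClusterPt xs atTop x) :
    ∀ k, N ≤ k → ‖x k - xs‖ ≤ B / (1 - s) * s ^ k := by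
  have hstep' : ∀ k, dist (x (N + k)) (x (N + (k + 1))) ≤ B * s ^ N * s ^ k := fun k => by
    rw [dist_comm, dist_eq_norm, mul_assoc, ← pow_add]
    exact hstep (N + k) (Nat.le_add_right _ _)
  obtain ⟨l, hl⟩ := cauchySeq_tendsto_of_complete (cauchySeq_of_le_geometric s _ hs1 hstep')
  have hlx : Tendsto x atTop (𝓝 l) := by
    rw [← tendsto_add_atTop_iff_nat N]
    simpa only [add_comm] using hl
  obtain ⟨U, hU, hUx⟩ := mapClusterPt_iff_ultrafilter.1 hcl
  obtain rfl : l = xs := tendsto_nhds_unique (hlx.mono_left hU) hUx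
  intro k hk
  obtain ⟨j, rfl⟩ := Nat.exists_eq_add_of_le hk
  have h := dist_le_of_le_geometric_of_tendsto s _ hs1 hstep' hl j
  rw [dist_eq_norm] at h
  refine h.trans_eq ?_
  rw [pow_add]
  ring

end ZeroOneCOP
end

noncomputable section

open Filter Topology
namespace ZeroOneCOP
variable {n m : ℕ} {P : ZeroOneCOP n m} {S : NALMParams}

/-- A cluster point of the iterates is a KKT point, and the Lyapunov values decrease to its value. -/
theorem IsApproxKKTSequence.cluster_point {x : ℕ → Euc n} {u y : ℕ → Euc m}
    (h : P.IsApproxKKTSequence S x u y) (hf : ContDiff ℝ 2 P.f) {ℓ β K : ℝ}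
    (hgrad : ∀ x x' : Euc n, ‖gradient P.f x - gradient P.f x'‖ ≤ ℓ * ‖x - x'‖)
    (hlam : 0 < P.lam) (hμ : 0 < S.mu) (hα : 0 < S.alpha)
    (heps : Tendsto S.eps atTop (𝓝 0)) (hβ : 0 ≤ β)
    (hr : ∀ k, ‖P.resid (x (k + 2)) (u (k + 2))‖
      ≤ K * (‖x (k + 2) - x (k + 1)‖ + ‖x (k + 1) - x k‖))
    (hdec : ∀ k, P.lyapSeq S β x u y (k + 2) + S.mu / 4 * ‖x (k + 2) - x (k + 1)‖ ^ 2
      ≤ P.lyapSeq S β x u y (k + 1))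
    {xs : Euc n} {us ys : Euc m}
    (hacc : MapClusterPt (xs, us, ys) atTop (fun k => (x k, u k, y k))) :
    gradient P.f xs + P.mulATL ys = 0 ∧ P.resid xs us = 0 ∧
      Tendsto (fun k => ‖x (k + 1) - x k‖) atTop (𝓝 0) ∧
      Tendsto (P.lyapSeq S β x u y) atTop (𝓝 (P.lyap S.rho β xs us ys xs)) ∧
      ∀ k, P.lyap S.rho β xs us ys xs ≤ P.lyapSeq S β x u y (k + 1) := by
  have hfc : Continuous P.f := hf.continuous
  obtain ⟨U, hU, hz⟩ := mapClusterPt_iff_ultrafilter.1 hacc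
  have hx : Tendsto x U (𝓝 xs) := (continuous_fst.tendsto _).comp hz
  have huy := (continuous_snd.tendsto _).comp hz
  have hu : Tendsto u U (𝓝 us) := (continuous_fst.tendsto _).comp huy
  have hy : Tendsto y U (𝓝 ys) := (continuous_snd.tendsto _).comp huy
  obtain ⟨L, hL, hLle, hstep⟩ := exists_tendsto_lyapSeq hfc hlam.le hβ (by positivity) hdec hU
    hx hu hy
  have hr0 : Tendsto (fun k => P.resid (x k) (u k)) atTop (𝓝 0) := by
    rw [← tendsto_add_atTop_iff_nat 2, tendsto_zero_iff_norm_tendsto_zero]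
    exact squeeze_zero (fun _ => norm_nonneg _) hr
      (by simpa using (((tendsto_add_atTop_iff_nat 1).2 hstep).add hstep).const_mul K)
  have hfeas : P.resid xs us = 0 := tendsto_nhds_unique (tendsto_resid hx hu) (hr0.mono_left hU)
  have hs0 : Tendsto (fun k => gradient P.f (x k) + P.mulATL (y k)) atTop (𝓝 0) := by
    rw [← tendsto_add_atTop_iff_nat 1, tendsto_zero_iff_norm_tendsto_zero]
    exact squeeze_zero (fun _ => norm_nonneg _) (h.stat' hμ)
      (by simpa using hstep.const_mul (S.mu + S.c₁))
  have hkkt : gradient P.f xs + P.mulATL ys = 0 :=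
    tendsto_nhds_unique
      ((((continuous_gradient_of_lipschitz hgrad).tendsto xs).comp hx).add
        ((P.mulATL.continuous.tendsto ys).comp hy)) (hs0.mono_left hU)
  have hstep' : Tendsto (fun k => β / 2 * ‖x k - x (k - 1)‖ ^ 2) U (𝓝 0) := by
    have h1 : Tendsto (fun k => ‖x k - x (k - 1)‖) atTop (𝓝 0) := by
      rw [← tendsto_add_atTop_iff_nat 1]
      simpa using hstep
    simpa using (((h1.pow 2).const_mul (β / 2)).mono_left hU)
  have hV : Tendsto (fun k => P.f (x k) + inner ℝ (y k) (P.resid (x k) (u k))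
      + S.rho / 2 * ‖P.resid (x k) (u k)‖ ^ 2 + P.lam * zeroOneLoss us
      + β / 2 * ‖x k - x (k - 1)‖ ^ 2) U (𝓝 (P.lyap S.rho β xs us ys xs)) := by
    have := ((tendsto_smoothLag hfc S.rho hx hu hy).add_const (P.lam * zeroOneLoss us)).add hstep'
    simpa [lyap, augLag] using this
  have hVeq : (fun k => P.f (x k) + inner ℝ (y k) (P.resid (x k) (u k))
      + S.rho / 2 * ‖P.resid (x k) (u k)‖ ^ 2 + P.lam * zeroOneLoss us
      + β / 2 * ‖x k - x (k - 1)‖ ^ 2) =ᶠ[U] P.lyapSeq S β x u y := by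
    have hloss : ∀ᶠ k in atTop, S.alpha ^ 2 / 2 * ‖y k‖ ^ 2
        + S.alpha * P.lam * zeroOneLoss (u k)
      ≤ S.alpha * P.lam * zeroOneLoss us + (1 / 2) * ‖us - (u k + S.alpha • y k)‖ ^ 2
        + S.eps (k - 1) := by
      filter_upwards [eventually_ge_atTop 1] with k hk
      obtain ⟨j, rfl⟩ := Nat.exists_eq_add_of_le' hk
      exact h.prox j us
    have heps' : Tendsto (fun k => S.eps (k - 1)) U (𝓝 0) := by
      refine Tendsto.mono_left ?_ hU
      rw [← tendsto_add_atTop_iff_nat 1]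
      simpa using heps
    filter_upwards [eventually_zeroOneLoss_ge hu,
      eventually_zeroOneLoss_le hα hlam hu hy heps' (hU hloss)] with k h1 h2
    simp only [lyapSeq, lyap, augLag, le_antisymm h2 h1]
  obtain rfl : L = P.lyap S.rho β xs us ys xs :=
    tendsto_nhds_unique (hL.mono_left hU) (hV.congr' hVeq)
  exact ⟨hkkt, hfeas, hstep, hL, hLle⟩

end ZeroOneCOP
end

theorem mainTheorem11 {n m : ℕ} (P : ZeroOneCOP n m) (S : NALMParams)
    (ℓf Lf ℓg γ c₃ c₄ β : ℝ)
    -- smoothness, weak convexity and coercivity of `f`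
    (hf : ContDiff ℝ 2 P.f)
    (hweak : ConvexOn ℝ Set.univ (fun x => P.f x + S.sigma / 2 * ‖x‖ ^ 2))
    (hgrad : ∀ x x' : Euc n, ‖gradient P.f x - gradient P.f x'‖ ≤ ℓf * ‖x - x'‖)
    (hhess : ∀ x x' : Euc n, ‖hessian P.f x - hessian P.f x'‖ ≤ Lf * ‖x - x'‖)
    (hcoer : Filter.Tendsto P.f (Filter.cocompact (Euc n)) Filter.atTop)
    -- full row rank of `A`, with `γ ^ 2` the smallest eigenvalue of `A * Aᵀ`
    (hrank : P.A.rank = m)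
    (hγ : 0 < γ) (hγA : IsLeast (spectrum ℝ (P.A * P.A.transpose)) (γ ^ 2))
    -- the parameters
    (hlam : 0 < P.lam) (hmu : 0 < S.mu) (hmuσ : S.sigma < S.mu)
    (hc₁ : 0 < S.c₁) (hc₂ : 0 < S.c₂)
    (heps : ∀ k, 0 < S.eps k) (heps0 : Filter.Tendsto S.eps Filter.atTop (nhds 0))
    (hc₃ : c₃ = (S.mu + ℓf + S.c₁) / γ) (hc₄ : c₄ = (S.mu + S.c₁) / γ)
    (hrho : max (8 * (c₃ ^ 2 + c₄ ^ 2) / S.mu) (4 * ℓf / γ ^ 2) < S.rho)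
    (hβ : β = 4 * c₄ ^ 2 / S.rho)
    (hℓg : 0 < ℓg) (hℓgLip : P.IsGradLipschitzModulus S ℓg)
    (hα : 0 < S.alpha) (hα' : S.alpha < 1 / ℓg)
    (ht : 0 < S.t) (ht' : S.t < 2 / ℓg)
    -- the generated sequence, and an accumulation point that satisfies the second-order condition
    (x : ℕ → Euc n) (u y : ℕ → Euc m) (hseq : P.IsINALMSequence S x u y)
    (xs : Euc n) (us ys : Euc m)
    (hacc : MapClusterPt (xs, us, ys) Filter.atTop (fun k => (x k, u k, y k)))
    (hsosc : P.SOSC xs us ys) :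
    (∃ q : ℝ, 0 < q ∧ q < 1 ∧ P.LyapunovRate S β x u y xs us ys q) ∧
    ∀ q : ℝ, 0 < q → q < 1 → P.LyapunovRate S β x u y xs us ys q →
      ∃ (kStar : ℕ) (cx cy cu : ℝ), 0 < cx ∧ 0 < cy ∧ 0 < cu ∧
        ∀ k, kStar ≤ k →
          ‖x k - xs‖ ≤ cx * Real.sqrt q ^ k ∧
          ‖y k - ys‖ ≤ cy * Real.sqrt q ^ k ∧
          ‖u k - us‖ ≤ cu * Real.sqrt q ^ k := by
  have hfd : Differentiable ℝ P.f := hf.differentiable two_ne_zero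
  have hγA' := P.gamma_mul_norm_le hγA
  have hρ1 := (le_max_left _ _).trans_lt hrho
  have hρ0 : 0 < S.rho := lt_of_le_of_lt (by positivity) hρ1
  have hβ0 : 0 ≤ β := by rw [hβ]; positivity
  have h := hseq.isApproxKKTSequence hfd hℓg hℓgLip hα hα' hlam ht ht' hmuσ
  have hdiff := h.dual_diff_le hgrad hγ hγA' hmu hc₃ hc₄
  have hdec := h.lyapSeq_succ_le hmu hρ0 hdiff hρ1 hβ
  have hr := h.resid_le hρ0 hdiff
  obtain ⟨hkkt, hfeas, hstep, hV, hVle⟩ :=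
    h.cluster_point hf hgrad hlam hmu hα heps0 hβ0 hr hdec hacc
  have hy := h.dual_error_le hgrad hγ hγA' hmu hc₁ hkkt
  set K : ℝ := S.rho⁻¹ * (|c₃| + |c₄|) with hK
  set Ky : ℝ := (|ℓf| + S.mu + S.c₁) / γ with hKy
  have hK0 : 0 ≤ K := by positivity
  have hKy0 : 0 < Ky := by positivity
  set V : ℝ := P.lyap S.rho β xs us ys xs with hVs
  have hxcl : MapClusterPt xs Filter.atTop x := by
    exact hacc.continuousAt_comp (f := Prod.fst) continuous_fst.continuousAt
  refine ⟨?_, fun q hq0 hq1 hrate => ?_⟩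
  · obtain ⟨C, δ, hC, hδ, k₀, hloc⟩ := h.exists_local_bound hf hgrad hlam hmu hρ0 hα hc₁ hc₂ heps0
      hβ0 hK0 hKy0.le hsosc hkkt hfeas hstep hr hy
    obtain ⟨q, hq0, hq1, N, hN, B, hB, hrate⟩ := exists_linear_rate_of_local_bound
      (a := fun k => P.lyapSeq S β x u y k - V) (c := S.mu / 4) (k₀ := max k₀ 1) (by positivity) hC hδ
      (fun k hk => by
        obtain ⟨j, rfl⟩ := Nat.exists_eq_add_of_le' ((le_max_right _ _).trans hk)
        have := hdec j
        simp only [add_assoc, Nat.reduceAdd] at *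
        linarith)
      (fun k hk => by
        obtain ⟨j, rfl⟩ := Nat.exists_eq_add_of_le' ((le_max_right _ _).trans hk)
        exact sub_nonneg.2 (hVle j))
      (by simpa using hV.sub_const V)
      (fun k hk => hloc k ((le_max_left _ _).trans hk))
      (by
        have := mapClusterPt_iff_frequently.1 hxcl _ (Metric.ball_mem_nhds xs (half_pos hδ))
        simpa [dist_eq_norm] using this)
    exact ⟨q, hq0, hq1, N, hN, B, hB, hrate⟩
  · obtain ⟨N, hN, c, hc, hrate⟩ := hrate
    set s : ℝ := Real.sqrt q with hs
    have hs0 : 0 < s := Real.sqrt_pos.2 hq0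
    have hs1 : s < 1 := by rw [hs, Real.sqrt_lt' one_pos, one_pow]; exact hq1
    have hsq : s ^ 2 = q := Real.sq_sqrt hq0.le
    set B : ℝ := Real.sqrt (c / (S.mu / 4)) with hB
    have hB0 : 0 < B := Real.sqrt_pos.2 (by positivity)
    have hstepB : ∀ k, N ≤ k → ‖x (k + 1) - x k‖ ≤ B * s ^ k := by
      intro k hk
      obtain ⟨j, rfl⟩ := Nat.exists_eq_add_of_le' (hN.trans hk)
      refine abs_le_of_sq_le_sq' ?_ (by positivity) |>.2
      have h1 := hdec j
      have h2 := hVle (j + 1)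
      have h3 := hrate (j + 1) hk
      have h4 : (B * s ^ (j + 1)) ^ 2 = c * q ^ (j + 1) / (S.mu / 4) := by
        rw [mul_pow, ← pow_mul, mul_comm (j + 1) 2, pow_mul, hsq, hB, Real.sq_sqrt (by positivity)]
        ring
      rw [h4, le_div_iff₀ (by positivity)]
      simp only [add_assoc, Nat.reduceAdd] at *
      linarith
    have h1s : 0 < 1 - s := by linarith
    have hx := exists_norm_sub_le_of_step_le hs1 hstepB hxcl
    set cx : ℝ := B / (1 - s) with hcx
    have hcx0 : 0 < cx := by positivity
    refine ⟨N + 2, cx, Ky * (cx + B / s), ‖P.mulAL‖ * cx + K * (B / s + B / s ^ 2) + 1, hcx0,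
      by positivity, by positivity, fun k hk => ?_⟩
    obtain ⟨j, rfl⟩ := Nat.exists_eq_add_of_le' ((Nat.le_add_left 2 N).trans hk)
    have hj : N ≤ j := by omega
    have hx2 := hx (j + 2) (by omega)
    have hs1' : ‖x (j + 2) - x (j + 1)‖ ≤ B / s * s ^ (j + 2) := by
      refine (hstepB (j + 1) (by omega)).trans_eq ?_
      rw [pow_succ s (j + 1)]
      field_simp
    have hs2' : ‖x (j + 1) - x j‖ ≤ B / s ^ 2 * s ^ (j + 2) := by
      refine (hstepB j hj).trans_eq ?_
      rw [pow_add s j 2]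
      field_simp
    refine ⟨hx2, ?_, ?_⟩
    · refine (hy (j + 1)).trans ?_
      rw [mul_assoc, add_mul]
      exact mul_le_mul_of_nonneg_left (add_le_add hx2 hs1') hKy0.le
    · have h1 : u (j + 2) - us = P.mulAL (x (j + 2) - xs) - P.resid (x (j + 2)) (u (j + 2)) := by
        rw [ZeroOneCOP.mulAL_sub_of_resid_eq_zero hfeas (x (j + 2)) (u (j + 2))]
        abel
      have h2 : ‖P.mulAL (x (j + 2) - xs)‖ ≤ ‖P.mulAL‖ * (cx * s ^ (j + 2)) :=
        (P.mulAL.le_opNorm _).trans (mul_le_mul_of_nonneg_left hx2 (norm_nonneg _))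
      have h3 := (hr j).trans (mul_le_mul_of_nonneg_left (add_le_add hs1' hs2') hK0)
      have h4 : 0 < s ^ (j + 2) := by positivity
      rw [h1]
      refine (norm_sub_le _ _).trans ?_
      linarith
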